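/- Let $\mathbb{C}^2=\mathbb{R}^4$ carry its standard metric $\langle\cdot,\cdot\rangle$, complex structure $J$ and symplectic form $\omega=\sum_k dx_k\wedge dy_k$, so that $\langle V,W\rangle=\omega(V,JW)$. Let $f:\Sigma\to\mathbb{C}^2$ be a smooth (for instance, properly) immersed Lagrangian surface, i.e. $\Sigma$ is a smooth surface and $f$ is a smooth immersion with $f^*\omega=0$. Let $g$ be the induced metric, $A=(D^2f)^\perp$ the second fundamental form, $H=\operatorname{tr}_g A$, $\mathring{A}=A-\tfrac12\, g\otimes H$, and $$\check A(v,w)=A(v,w)-\tfrac14\big\{\langle v,w\rangle H+\langle Jv,H\rangle Jw+\langle Jw,H\rangle Jv\big\}.$$ For a normal-bundle-valued $(0,2)$-tensor $B$ and a normal field $\phi$ put $Q(B)\phi=\sum_{i,j}B(e_i,e_j)\langle B(e_i,e_j),\phi\rangle$, where $\{e_1,e_2\}$ is an orthonormal basis of the tangent plane. Let $\nabla$ denote the induced covariant derivatives on the tangent and normal bundles, $\nabla^*S=-\sum_i e_i\lrcorner\nabla_{e_i}S$, and $\Delta=-\nabla^*\nabla$. Let $\phi\lrcorner\omega$ be the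 $1$-form $v\mapsto\omega(\phi,v)$ on $\Sigma$, and let $T=\nabla(H\lrcorner\omega)-\tfrac12\operatorname{div}(JH)\,g$. Then the Willmore operator $W=\Delta H+Q(\mathring A)H$ satisfies $$W=\Delta H+\tfrac18|H|^2H+Q(\check A)H+\check A(JH,JH),$$ and, in the dual form, $$W\lrcorner\omega=-2\nabla^*T+\tfrac12|\check A|^2\,H\lrcorner\omega+\big(Q(\check A)H\big)\lrcorner\omega+\check A(JH,JH)\lrcorner\omega .$$ -/

import Mathlib

open scoped Manifold ContDiff

noncomputable section

namespace LagrangianSurface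

/-! ### The ambient space `ℂ²` -/

/-- The parameter plane `ℝ²` on which surfaces are modelled. -/
abbrev Plane : Type := EuclideanSpace ℝ (Fin 2)

/-- The ambient space `ℂ² = ℝ⁴`; its real inner product `inner ℝ v w = ∑ Re (conj vₖ * wₖ)` is the
standard Euclidean metric. -/
abbrev C2 : Type := EuclideanSpace ℂ (Fin 2)

/-- The standard complex structure of `ℂ²`. -/
def J (v : C2) : C2 := Complex.I • v

/-- The standard symplectic form `ω = ∑ dxₖ ∧ dyₖ` of `ℂ²`, where `zₖ = xₖ + i yₖ`;
it satisfies `⟨v, w⟩ = ω(v, J w)`. -/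
def omega (v w : C2) : ℝ := ∑ k, ((v k).re * (w k).im - (v k).im * (w k).re)

/-! ### Lagrangian immersions of surfaces -/

/-- A smooth immersion `f : M → ℂ²` of a surface with `f^* ω = 0`. -/
structure IsLagrangianImmersion {M : Type*} [TopologicalSpace M] [ChartedSpace Plane M]
    (f : M → C2) : Prop where
  smooth : ContMDiff 𝓘(ℝ, Plane) 𝓘(ℝ, C2) ∞ f
  injective_mfderiv : ∀ p : M, Function.Injective (mfderiv 𝓘(ℝ, Plane) 𝓘(ℝ, C2) f p)
  lagrangian : ∀ (p : M) (v w : TangentSpace 𝓘(ℝ, Plane) p),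
    omega (mfderiv 𝓘(ℝ, Plane) 𝓘(ℝ, C2) f p v) (mfderiv 𝓘(ℝ, Plane) 𝓘(ℝ, C2) f p w) = 0

/-! ### Geometry of a surface in local coordinates

Below `u : ℝ² → ℂ²` is an immersion on a neighbourhood of `x` (a surface written in a coordinate
chart). Tensors on the surface are given by their components with respect to the coordinate fields
`∂₀, ∂₁`; a tensor with values in the normal bundle has components in `ℂ²`. -/

/-- The partial derivative `∂ᵢ φ` of a (vector valued) function on the parameter plane. -/
def pd {V : Type*} [NormedAddCommGroup V] [NormedSpace ℝ V] (i : Fin 2) (φ : Plane → V)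
    (x : Plane) : V :=
  fderiv ℝ φ x (EuclideanSpace.single i 1)

/-- The induced metric `g_{ij} = ⟨∂ᵢ u, ∂ⱼ u⟩`. -/
def metric (u : Plane → C2) (x : Plane) : Matrix (Fin 2) (Fin 2) ℝ :=
  Matrix.of fun i j => inner ℝ (pd i u x) (pd j u x)

/-- The inverse metric `g^{ij}`. -/
def metricInv (u : Plane → C2) (x : Plane) : Matrix (Fin 2) (Fin 2) ℝ := (metric u x)⁻¹

/-- The Christoffel symbols `Γᵏ_{ij}` of the Levi-Civita connection of the induced metric. -/
def christoffel (u : Plane → C2) (k i j : Fin 2) (x : Plane) : ℝ :=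
  (1 / 2) * ∑ l, metricInv u x k l *
    (pd i (fun y => metric u y j l) x + pd j (fun y => metric u y i l) x
      - pd l (fun y => metric u y i j) x)

/-- The components `Vⁱ` of the tangential part of an ambient vector `V`, that is,
`V^⊤ = ∑ Vⁱ ∂ᵢ u`. -/
def tangComp (u : Plane → C2) (x : Plane) (V : C2) (i : Fin 2) : ℝ :=
  ∑ k, metricInv u x i k * inner ℝ V (pd k u x)

/-- The normal part `V^⊥` of an ambient vector `V`. -/
def normalPart (u : Plane → C2) (x : Plane) (V : C2) : C2 :=
  V - ∑ i, tangComp u x V i • pd i u x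

/-- The second fundamental form `A_{ij} = (∂ᵢ ∂ⱼ u)^⊥`. -/
def secondFF (u : Plane → C2) (i j : Fin 2) (x : Plane) : C2 :=
  normalPart u x (pd i (pd j u) x)

/-- The mean curvature vector `H = tr A`. -/
def meanCurv (u : Plane → C2) (x : Plane) : C2 :=
  ∑ i, ∑ j, metricInv u x i j • secondFF u i j x

/-- The trace-free second fundamental form `Å = A - ½ g ⊗ H`. -/
def tracefreeA (u : Plane → C2) (i j : Fin 2) (x : Plane) : C2 :=
  secondFF u i j x - ((1 / 2 : ℝ) * metric u x i j) • meanCurv u x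

/-- The Lagrangian trace-free second fundamental form
`Ǎ(v, w) = A(v, w) - ¼ (⟨v, w⟩ H + ⟨J v, H⟩ J w + ⟨J w, H⟩ J v)`. -/
def checkA (u : Plane → C2) (i j : Fin 2) (x : Plane) : C2 :=
  secondFF u i j x - (1 / 4 : ℝ) •
    (metric u x i j • meanCurv u x
      + (inner ℝ (J (pd i u x)) (meanCurv u x) : ℝ) • J (pd j u x)
      + (inner ℝ (J (pd j u x)) (meanCurv u x) : ℝ) • J (pd i u x))

/-- `Q(B) φ = ∑ B(eₐ, e_b) ⟨B(eₐ, e_b), φ⟩` over an orthonormal basis `e₀, e₁` of the tangent plane,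
written as a contraction with the metric. Here `B` is a `ℂ²`-valued two-tensor. -/
def Qop (u : Plane → C2) (B : Fin 2 → Fin 2 → Plane → C2) (φ : Plane → C2) (x : Plane) : C2 :=
  ∑ i, ∑ j, ∑ k, ∑ l,
    (metricInv u x i k * metricInv u x j l * inner ℝ (B k l x) (φ x)) • B i j x

/-- The squared norm `|B|²` of a `ℂ²`-valued two-tensor. -/
def normSqTensor (u : Plane → C2) (B : Fin 2 → Fin 2 → Plane → C2) (x : Plane) : ℝ :=
  ∑ i, ∑ j, ∑ k, ∑ l, metricInv u x i k * metricInv u x j l * inner ℝ (B i j x) (B k l x)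

/-- The value `B(V, V)` of a `ℂ²`-valued two-tensor on a tangent vector `V ∈ ℂ²` of the surface. -/
def evalDiag (u : Plane → C2) (B : Fin 2 → Fin 2 → Plane → C2) (V : Plane → C2) (x : Plane) : C2 :=
  ∑ i, ∑ j, (tangComp u x (V x) i * tangComp u x (V x) j) • B i j x

/-- The covariant derivative `(∇φ)ⱼ = (∂ⱼ φ)^⊥` of a normal field. -/
def normalDeriv (u : Plane → C2) (φ : Plane → C2) (j : Fin 2) (x : Plane) : C2 :=
  normalPart u x (pd j φ x)

/-- The covariant derivative `(∇θ)_{ij} = (∂ᵢ θⱼ)^⊥ - Γᵏ_{ij} θₖ` of a one-form with values in the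
normal bundle; `i` is the direction of differentiation. -/
def normalDerivForm (u : Plane → C2) (θ : Fin 2 → Plane → C2) (i j : Fin 2) (x : Plane) : C2 :=
  normalPart u x (pd i (θ j) x) - ∑ k, christoffel u k i j x • θ k x

/-- The rough Laplacian `Δφ = -∇^* ∇φ = g^{ij} (∇²φ)_{ij}` on the normal bundle. -/
def normalLaplacian (u : Plane → C2) (φ : Plane → C2) (x : Plane) : C2 :=
  ∑ i, ∑ j, metricInv u x i j • normalDerivForm u (normalDeriv u φ) i j x

/-- The Willmore operator `W = ΔH + Q(Å) H`. -/
def willmoreOp (u : Plane → C2) (x : Plane) : C2 :=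
  normalLaplacian u (meanCurv u) x + Qop u (tracefreeA u) (meanCurv u) x

/-- The one-form `V ⌟ ω` on the surface, for a `ℂ²`-valued field `V`:
its components are `ω(V, ∂ᵢ u)`. -/
def contract (u : Plane → C2) (V : Plane → C2) (i : Fin 2) (x : Plane) : ℝ :=
  omega (V x) (pd i u x)

/-- The covariant derivative `(∇θ)_{ij} = ∂ᵢ θⱼ - Γᵏ_{ij} θₖ` of a one-form. -/
def covDerivForm (u : Plane → C2) (θ : Fin 2 → Plane → ℝ) (i j : Fin 2) (x : Plane) : ℝ :=
  pd i (θ j) x - ∑ k, christoffel u k i j x * θ k x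

/-- The covariant derivative `(∇S)_{ijk} = ∂ᵢ S_{jk} - Γˡ_{ij} S_{lk} - Γˡ_{ik} S_{jl}` of a
`(0,2)`-tensor. -/
def covDerivTensor (u : Plane → C2) (S : Fin 2 → Fin 2 → Plane → ℝ) (i j k : Fin 2)
    (x : Plane) : ℝ :=
  pd i (S j k) x - ∑ l, christoffel u l i j x * S l k x - ∑ l, christoffel u l i k x * S j l x

/-- The adjoint `∇^* S = -∑ eₐ ⌟ ∇_{eₐ} S` of the covariant derivative on `(0,2)`-tensors. -/
def adjointDeriv (u : Plane → C2) (S : Fin 2 → Fin 2 → Plane → ℝ) (k : Fin 2) (x : Plane) : ℝ :=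
  -∑ i, ∑ j, metricInv u x i j * covDerivTensor u S i j k x

/-- The divergence `div V = ∂ᵢ Vⁱ + Γⁱ_{ik} Vᵏ` of a tangent vector field `V`, given as a
`ℂ²`-valued function. -/
def divergence (u : Plane → C2) (V : Plane → C2) (x : Plane) : ℝ :=
  ∑ i, (pd i (fun y => tangComp u y (V y) i) x
    + ∑ k, christoffel u i i k x * tangComp u x (V x) k)

/-- The `(0,2)`-tensor `T = ∇(H ⌟ ω) - ½ div(JH) g`. -/
def tensorT (u : Plane → C2) (i j : Fin 2) (x : Plane) : ℝ :=
  covDerivForm u (contract u (meanCurv u)) i j x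
    - (1 / 2) * divergence u (fun y => J (meanCurv u y)) x * metric u x i j

end LagrangianSurface

end

/-!
The mean curvature form `H ⌟ ω` of a Lagrangian surface is dual to the tangent vector field `JH`.

For a Lagrangian surface the trilinear form `⟨A(·, ·), J ·⟩` is totally symmetric, and `A - Ǎ` is
its pure trace part, built from `H` alone. Contracting this part with symmetric tensors expresses
`Q(Ǎ) H`, `Ǎ(JH, JH)` and `|Ǎ|²` through `A` and `H`, whence
`Q(Å) H = ⅛ |H|² H + Q(Ǎ) H + Ǎ(JH, JH)` and `|Ǎ|² = |A|² - ¾ |H|²`.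

The frame `∂₀ u, ∂₁ u` is a complex basis of `ℂ²`, and the logarithmic derivative of its determinant
is `Γᵏ_{jk} - i (H ⌟ ω)ⱼ`. Equality of mixed partial derivatives makes `H ⌟ ω` closed, so
`∇(H ⌟ ω)` is symmetric. Commuting derivatives then gives the Bochner formula
`Δ(H ⌟ ω) = d div(JH) + K H ⌟ ω`, in which `|H|² - |A|² = 2K` by the Gauss equation. As `J` is
parallel, `Δ(H ⌟ ω) = (ΔH) ⌟ ω`.
-/

namespace LagrangianSurface

open Matrix

/-! ### Partial derivatives -/

section PartialDerivatives

variable {V W : Type*} [NormedAddCommGroup V] [NormedSpace ℝ V] [NormedAddCommGroup W]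
  [NormedSpace ℝ W] {U : Set Plane} {x : Plane}

theorem pd_congr (hU : IsOpen U) (hx : x ∈ U) {φ ψ : Plane → V} (h : Set.EqOn φ ψ U) (i : Fin 2) :
    pd i φ x = pd i ψ x := by
  rw [pd, pd, (h.eventuallyEq_of_mem (hU.mem_nhds hx)).fderiv_eq]

theorem pd_const (c : V) (i : Fin 2) : pd i (fun _ => c) x = 0 := by
  simp [pd]

theorem pd_sub {φ ψ : Plane → V} (hφ : DifferentiableAt ℝ φ x) (hψ : DifferentiableAt ℝ ψ x)
    (i : Fin 2) : pd i (fun y => φ y - ψ y) x = pd i φ x - pd i ψ x := by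
  simp [pd, fderiv_fun_sub hφ hψ]

theorem pd_sum {ι : Type*} {s : Finset ι} {φ : ι → Plane → V}
    (hφ : ∀ a ∈ s, DifferentiableAt ℝ (φ a) x) (i : Fin 2) :
    pd i (fun y => ∑ a ∈ s, φ a y) x = ∑ a ∈ s, pd i (φ a) x := by
  simp [pd, fderiv_fun_sum hφ]

theorem pd_mul {𝔸 : Type*} [NormedCommRing 𝔸] [NormedAlgebra ℝ 𝔸] {φ ψ : Plane → 𝔸}
    (hφ : DifferentiableAt ℝ φ x) (hψ : DifferentiableAt ℝ ψ x) (i : Fin 2) :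
    pd i (fun y => φ y * ψ y) x = pd i φ x * ψ x + φ x * pd i ψ x := by
  simp [pd, fderiv_fun_mul hφ hψ, mul_comm, add_comm]

theorem pd_sum_mul {ι 𝔸 : Type*} {s : Finset ι} [NormedCommRing 𝔸] [NormedAlgebra ℝ 𝔸]
    {φ ψ : ι → Plane → 𝔸} (hφ : ∀ a ∈ s, DifferentiableAt ℝ (φ a) x)
    (hψ : ∀ a ∈ s, DifferentiableAt ℝ (ψ a) x) (i : Fin 2) :
    pd i (fun y => ∑ a ∈ s, φ a y * ψ a y) x
      = ∑ a ∈ s, (pd i (φ a) x * ψ a x + φ a x * pd i (ψ a) x) := by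
  rw [pd_sum fun a ha => (hφ a ha).fun_mul (hψ a ha)]
  exact Finset.sum_congr rfl fun a ha => pd_mul (hφ a ha) (hψ a ha) i

theorem pd_smul {c : Plane → ℝ} {φ : Plane → V} (hc : DifferentiableAt ℝ c x)
    (hφ : DifferentiableAt ℝ φ x) (i : Fin 2) :
    pd i (fun y => c y • φ y) x = pd i c x • φ x + c x • pd i φ x := by
  simp [pd, fderiv_fun_smul hc hφ, add_comm]

theorem pd_inner {E : Type*} [NormedAddCommGroup E] [InnerProductSpace ℝ E] {φ ψ : Plane → E}
    (hφ : DifferentiableAt ℝ φ x) (hψ : DifferentiableAt ℝ ψ x) (i : Fin 2) :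
    pd i (fun y => inner ℝ (φ y) (ψ y)) x
      = inner ℝ (pd i φ x) (ψ x) + inner ℝ (φ x) (pd i ψ x) := by
  rw [pd, fderiv_inner_apply ℝ hφ hψ, add_comm, pd, pd]

theorem pd_clm_comp (L : V →L[ℝ] W) {φ : Plane → V} (hφ : DifferentiableAt ℝ φ x) (i : Fin 2) :
    pd i (fun y => L (φ y)) x = L (pd i φ x) :=
  congrArg (· (EuclideanSpace.single i 1)) (L.hasFDerivAt.comp x hφ.hasFDerivAt).fderiv

theorem differentiableAt_of_contDiffOn (hU : IsOpen U) (hx : x ∈ U) {φ : Plane → V}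
    (h : ContDiffOn ℝ ∞ φ U) : DifferentiableAt ℝ φ x :=
  (h.contDiffAt (hU.mem_nhds hx)).differentiableAt (by simp)

theorem contDiffOn_pd (hU : IsOpen U) {φ : Plane → V} (h : ContDiffOn ℝ ∞ φ U) (i : Fin 2) :
    ContDiffOn ℝ ∞ (pd i φ) U :=
  (h.fderiv_of_isOpen hU (by simp)).clm_apply contDiffOn_const

theorem pd_comm (hU : IsOpen U) (hx : x ∈ U) {φ : Plane → V} (h : ContDiffOn ℝ ∞ φ U)
    (i j : Fin 2) : pd i (pd j φ) x = pd j (pd i φ) x := by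
  have hφ : ContDiffAt ℝ ∞ φ x := h.contDiffAt (hU.mem_nhds hx)
  have hdφ : DifferentiableAt ℝ (fderiv ℝ φ) x :=
    (hφ.fderiv_right (m := 1) (by norm_cast)).differentiableAt (by simp)
  have pd_pd_eq_fderiv_fderiv : ∀ i j : Fin 2, pd i (pd j φ) x
      = fderiv ℝ (fderiv ℝ φ) x (EuclideanSpace.single i 1) (EuclideanSpace.single j 1) := by
    intro i j
    have hpd : pd j φ = fun y => fderiv ℝ φ y (EuclideanSpace.single j 1) := rfl
    rw [hpd, pd, fderiv_clm_apply hdφ (differentiableAt_const _)]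
    simp
  rw [pd_pd_eq_fderiv_fderiv, pd_pd_eq_fderiv_fderiv]
  have hsmooth : minSmoothness ℝ 2 ≤ ∞ := by
    rw [minSmoothness_of_isRCLikeNormedField]
    norm_cast
  exact (hφ.isSymmSndFDerivAt hsmooth).eq _ _

theorem pd_comm_of_pd_eq_mul {F : Plane → ℂ} {w : Fin 2 → Plane → ℂ} (hU : IsOpen U) (hx : x ∈ U)
    (hF : ContDiffOn ℝ ∞ F U) (hFx : F x ≠ 0) (hw : ∀ j, DifferentiableAt ℝ (w j) x)
    (h : ∀ j, Set.EqOn (pd j F) (fun y => w j y * F y) U) (i j : Fin 2) :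
    pd i (w j) x = pd j (w i) x := by
  have pd_pd_F : ∀ i j, pd i (pd j F) x = pd i (w j) x * F x + w j x * (w i x * F x) := by
    intro i j
    rw [pd_congr hU hx (h j), pd_mul (hw j) (differentiableAt_of_contDiffOn hU hx hF), h i hx]
  have hcomm := pd_comm hU hx hF i j
  rw [pd_pd_F, pd_pd_F] at hcomm
  exact mul_right_cancel₀ hFx (by linear_combination hcomm)

end PartialDerivatives

/-! ### The complex structure -/

section ComplexStructure

/-- The complex structure `J` as a real continuous linear map. -/
noncomputable def JCLM : C2 →L[ℝ] C2 :=
  (Complex.I • ContinuousLinearMap.id ℂ C2).restrictScalars ℝ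

theorem J_add (v w : C2) : J (v + w) = J v + J w := smul_add _ _ _

theorem J_sub (v w : C2) : J (v - w) = J v - J w := smul_sub _ _ _

theorem J_smul (c : ℝ) (v : C2) : J (c • v) = c • J v := JCLM.map_smul c v

theorem J_sum {ι : Type*} (s : Finset ι) (v : ι → C2) : J (∑ a ∈ s, v a) = ∑ a ∈ s, J (v a) :=
  Finset.smul_sum

theorem J_J (v : C2) : J (J v) = -v := by
  simp [J, smul_smul]

theorem re_J_apply (v : C2) (k : Fin 2) : (J v k).re = -(v k).im := by
  simp [J]

theorem im_J_apply (v : C2) (k : Fin 2) : (J v k).im = (v k).re := by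
  simp [J]

theorem inner_eq_sum_re_im (v w : C2) :
    inner ℝ v w = ∑ k, ((v k).re * (w k).re + (v k).im * (w k).im) := by
  simp [PiLp.inner_apply, Complex.inner, mul_comm]

theorem omega_eq_inner (v w : C2) : omega v w = inner ℝ (J v) w := by
  rw [omega, inner_eq_sum_re_im]
  refine Finset.sum_congr rfl fun k _ => ?_
  rw [re_J_apply, im_J_apply]
  ring

theorem inner_J_left (v w : C2) : inner ℝ (J v) w = -inner ℝ v (J w) := by
  rw [inner_eq_sum_re_im, inner_eq_sum_re_im, ← Finset.sum_neg_distrib]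
  refine Finset.sum_congr rfl fun k _ => ?_
  rw [re_J_apply, im_J_apply, re_J_apply, im_J_apply]
  ring

theorem inner_J_J (v w : C2) : inner ℝ (J v) (J w) = inner ℝ v w := by
  rw [inner_J_left, J_J, inner_neg_right, neg_neg]

theorem inner_complex_eq (v w : C2) :
    inner ℂ v w = inner ℝ v w + inner ℝ (J v) w * Complex.I := by
  rw [← omega_eq_inner, omega, inner_eq_sum_re_im]
  apply Complex.ext
  · simp [PiLp.inner_apply, mul_comm]
  · simp [PiLp.inner_apply, mul_comm, sub_eq_neg_add, add_comm]

variable {φ : Plane → C2}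

theorem pd_J {x : Plane} (hφ : DifferentiableAt ℝ φ x) (i : Fin 2) :
    pd i (fun y => J (φ y)) x = J (pd i φ x) :=
  pd_clm_comp JCLM hφ i

theorem contDiffOn_J {U : Set Plane} (h : ContDiffOn ℝ ∞ φ U) :
    ContDiffOn ℝ ∞ (fun y => J (φ y)) U :=
  JCLM.contDiff.comp_contDiffOn h

end ComplexStructure

/-! ### Linear algebra at a point of the surface -/

section Pointwise

variable {u : Plane → C2} {x : Plane} {V N : C2}

/-- `N` is a normal vector of the surface at the point with coordinates `x`. -/
def IsNormal (u : Plane → C2) (x : Plane) (N : C2) : Prop :=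
  ∀ i, inner ℝ N (pd i u x) = 0

/-- `V` is a tangent vector of the surface at the point with coordinates `x`: it agrees with its
tangential part. -/
def IsTangent (u : Plane → C2) (x : Plane) (V : C2) : Prop :=
  ∑ i, tangComp u x V i • pd i u x = V

theorem metric_apply (u : Plane → C2) (x : Plane) (i j : Fin 2) :
    metric u x i j = inner ℝ (pd i u x) (pd j u x) := rfl

theorem metric_isSymm (u : Plane → C2) (x : Plane) : (metric u x).IsSymm :=
  Matrix.IsSymm.ext fun i j => real_inner_comm (pd i u x) (pd j u x)

theorem metricInv_isSymm (u : Plane → C2) (x : Plane) : (metricInv u x).IsSymm := by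
  rw [Matrix.IsSymm, metricInv, Matrix.transpose_nonsing_inv, metric_isSymm u x]

theorem tangComp_eq_mulVec (u : Plane → C2) (x : Plane) (V : C2) :
    tangComp u x V = metricInv u x *ᵥ fun k => inner ℝ V (pd k u x) := rfl

theorem IsTangent.inner_eq_zero (hV : IsTangent u x V) (hN : IsNormal u x N) :
    inner ℝ V N = 0 := by
  rw [← hV, real_inner_comm]
  simp only [inner_sum, real_inner_smul_right, hN _, mul_zero, Finset.sum_const_zero]

theorem IsNormal.inner_normalPart (hN : IsNormal u x N) (V : C2) :
    inner ℝ (normalPart u x V) N = inner ℝ V N := by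
  rw [real_inner_comm, real_inner_comm N]
  simp only [normalPart, inner_sub_right, inner_sum, real_inner_smul_right, hN _, mul_zero,
    Finset.sum_const_zero, sub_zero]

variable (hg : (metric u x).det ≠ 0)

include hg

theorem metricInv_mul_metric : metricInv u x * metric u x = 1 :=
  Matrix.nonsing_inv_mul _ hg.isUnit

theorem metric_mul_metricInv : metric u x * metricInv u x = 1 :=
  Matrix.mul_nonsing_inv _ hg.isUnit

theorem metric_mulVec_tangComp (V : C2) :
    metric u x *ᵥ tangComp u x V = fun k => inner ℝ V (pd k u x) := by
  rw [tangComp_eq_mulVec, Matrix.mulVec_mulVec, metric_mul_metricInv hg, Matrix.one_mulVec]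

theorem sum_tangComp_mul_metric (V : C2) (k : Fin 2) :
    ∑ i, tangComp u x V i * metric u x i k = inner ℝ V (pd k u x) := by
  rw [← congrFun (metric_mulVec_tangComp hg V) k, Matrix.mulVec, dotProduct]
  exact Finset.sum_congr rfl fun i _ => by rw [mul_comm, (metric_isSymm u x).apply]

theorem isNormal_normalPart (V : C2) : IsNormal u x (normalPart u x V) := fun k => by
  simp only [normalPart, inner_sub_left, sum_inner, real_inner_smul_left, ← metric_apply,
    sum_tangComp_mul_metric hg, sub_self]

theorem isNormal_secondFF (i j : Fin 2) : IsNormal u x (secondFF u i j x) :=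
  isNormal_normalPart hg _

theorem isNormal_meanCurv : IsNormal u x (meanCurv u x) := fun k => by
  simp only [meanCurv, sum_inner, real_inner_smul_left, isNormal_secondFF hg _ _ k, mul_zero,
    Finset.sum_const_zero]

end Pointwise

/-! ### Charts of immersed surfaces -/

/-- The function `u` is a smooth immersion of the open subset `U` of the parameter plane; the
immersion condition is expressed by the invertibility of the induced metric. -/
structure IsImmersedChart (u : Plane → C2) (U : Set Plane) : Prop where
  isOpen : IsOpen U
  contDiffOn : ContDiffOn ℝ ∞ u U
  det_metric_ne_zero : ∀ ⦃y⦄, y ∈ U → (metric u y).det ≠ 0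

namespace IsImmersedChart

section Smoothness

variable {u V : Plane → C2} {U : Set Plane} (hu : IsImmersedChart u U)

include hu

theorem differentiableAt {E : Type*} [NormedAddCommGroup E] [NormedSpace ℝ E] {x : Plane}
    (hx : x ∈ U) {φ : Plane → E} (hφ : ContDiffOn ℝ ∞ φ U) : DifferentiableAt ℝ φ x :=
  differentiableAt_of_contDiffOn hu.isOpen hx hφ

theorem contDiffOn_pd (i : Fin 2) : ContDiffOn ℝ ∞ (pd i u) U :=
  LagrangianSurface.contDiffOn_pd hu.isOpen hu.contDiffOn i

theorem contDiffOn_metric (i j : Fin 2) : ContDiffOn ℝ ∞ (fun y => metric u y i j) U :=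
  (hu.contDiffOn_pd i).inner ℝ (hu.contDiffOn_pd j)

theorem contDiffOn_metricInv (i j : Fin 2) : ContDiffOn ℝ ∞ (fun y => metricInv u y i j) U := by
  have hdet : ContDiffOn ℝ ∞ (fun y => (metric u y).det) U := by
    simp only [Matrix.det_fin_two]
    exact ((hu.contDiffOn_metric 0 0).mul (hu.contDiffOn_metric 1 1)).sub
      ((hu.contDiffOn_metric 0 1).mul (hu.contDiffOn_metric 1 0))
  have hadj : ContDiffOn ℝ ∞ (fun y => (metric u y).adjugate i j) U := by
    simp only [Matrix.adjugate_fin_two]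
    fin_cases i <;> fin_cases j
    · exact hu.contDiffOn_metric 1 1
    · exact (hu.contDiffOn_metric 0 1).neg
    · exact (hu.contDiffOn_metric 1 0).neg
    · exact hu.contDiffOn_metric 0 0
  simp only [metricInv, Matrix.inv_def, Ring.inverse_eq_inv', Matrix.smul_apply, smul_eq_mul]
  exact (hdet.inv hu.det_metric_ne_zero).mul hadj

theorem contDiffOn_tangComp (hV : ContDiffOn ℝ ∞ V U) (i : Fin 2) :
    ContDiffOn ℝ ∞ (fun y => tangComp u y (V y) i) U :=
  ContDiffOn.sum fun k _ => (hu.contDiffOn_metricInv i k).mul (hV.inner ℝ (hu.contDiffOn_pd k))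

theorem contDiffOn_normalPart (hV : ContDiffOn ℝ ∞ V U) :
    ContDiffOn ℝ ∞ (fun y => normalPart u y (V y)) U :=
  hV.sub (ContDiffOn.sum fun i _ => (hu.contDiffOn_tangComp hV i).smul (hu.contDiffOn_pd i))

theorem contDiffOn_normalDeriv (hV : ContDiffOn ℝ ∞ V U) (j : Fin 2) :
    ContDiffOn ℝ ∞ (normalDeriv u V j) U :=
  hu.contDiffOn_normalPart (LagrangianSurface.contDiffOn_pd hu.isOpen hV j)

theorem contDiffOn_secondFF (i j : Fin 2) : ContDiffOn ℝ ∞ (secondFF u i j) U :=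
  hu.contDiffOn_normalPart (LagrangianSurface.contDiffOn_pd hu.isOpen (hu.contDiffOn_pd j) i)

theorem contDiffOn_meanCurv : ContDiffOn ℝ ∞ (meanCurv u) U :=
  ContDiffOn.sum fun i _ => ContDiffOn.sum fun j _ =>
    (hu.contDiffOn_metricInv i j).smul (hu.contDiffOn_secondFF i j)

theorem contDiffOn_christoffel (k i j : Fin 2) : ContDiffOn ℝ ∞ (christoffel u k i j) U :=
  contDiffOn_const.mul <| ContDiffOn.sum fun l _ => (hu.contDiffOn_metricInv k l).mul <|
    ((LagrangianSurface.contDiffOn_pd hu.isOpen (hu.contDiffOn_metric j l) i).add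
      (LagrangianSurface.contDiffOn_pd hu.isOpen (hu.contDiffOn_metric i l) j)).sub
      (LagrangianSurface.contDiffOn_pd hu.isOpen (hu.contDiffOn_metric i j) l)

theorem contDiffOn_covDerivForm {θ : Fin 2 → Plane → ℝ} (hθ : ∀ i, ContDiffOn ℝ ∞ (θ i) U)
    (i j : Fin 2) : ContDiffOn ℝ ∞ (covDerivForm u θ i j) U :=
  (LagrangianSurface.contDiffOn_pd hu.isOpen (hθ j) i).sub <| ContDiffOn.sum fun k _ =>
    (hu.contDiffOn_christoffel k i j).mul (hθ k)

theorem contDiffOn_sum_metricInv_mul {S : Fin 2 → Fin 2 → Plane → ℝ}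
    (hS : ∀ i j, ContDiffOn ℝ ∞ (S i j) U) :
    ContDiffOn ℝ ∞ (fun y => ∑ i, ∑ j, metricInv u y i j * S i j y) U :=
  ContDiffOn.sum fun i _ => ContDiffOn.sum fun j _ => (hu.contDiffOn_metricInv i j).mul (hS i j)

end Smoothness

/-! ### The Levi-Civita connection -/

section LeviCivita

variable {u V : Plane → C2} {U : Set Plane} {x : Plane} (hu : IsImmersedChart u U) (hx : x ∈ U)

include hu hx

theorem pd_pd_comm (i j : Fin 2) : pd i (pd j u) x = pd j (pd i u) x :=
  pd_comm hu.isOpen hx hu.contDiffOn i j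

theorem secondFF_symm (i j : Fin 2) : secondFF u i j x = secondFF u j i x := by
  rw [secondFF, secondFF, hu.pd_pd_comm hx]

theorem pd_metric (k i j : Fin 2) : pd k (fun y => metric u y i j) x
    = inner ℝ (pd k (pd i u) x) (pd j u x) + inner ℝ (pd i u x) (pd k (pd j u) x) :=
  pd_inner (hu.differentiableAt hx (hu.contDiffOn_pd i))
    (hu.differentiableAt hx (hu.contDiffOn_pd j)) k

theorem christoffel_eq_tangComp (k i j : Fin 2) :
    christoffel u k i j x = tangComp u x (pd i (pd j u) x) k := by
  simp only [christoffel, tangComp, hu.pd_metric hx, Finset.mul_sum]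
  refine Finset.sum_congr rfl fun l _ => ?_
  rw [hu.pd_pd_comm hx j i, hu.pd_pd_comm hx l i, hu.pd_pd_comm hx l j,
    real_inner_comm _ (pd j u x), real_inner_comm _ (pd i u x)]
  ring

theorem christoffel_symm (k i j : Fin 2) : christoffel u k i j x = christoffel u k j i x := by
  rw [hu.christoffel_eq_tangComp hx, hu.christoffel_eq_tangComp hx, hu.pd_pd_comm hx]

theorem pd_pd_eq_secondFF_add (i j : Fin 2) : pd i (pd j u) x
    = secondFF u i j x + ∑ k, christoffel u k i j x • pd k u x := by
  simp only [secondFF, normalPart, hu.christoffel_eq_tangComp hx, sub_add_cancel]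

theorem pd_metric_eq_christoffel (k i j : Fin 2) : pd k (fun y => metric u y i j) x
    = ∑ l, christoffel u l k i x * metric u x l j
      + ∑ l, christoffel u l k j x * metric u x l i := by
  rw [hu.pd_metric hx]
  simp only [hu.christoffel_eq_tangComp hx,
    sum_tangComp_mul_metric (hu.det_metric_ne_zero hx)]
  rw [real_inner_comm (pd k (pd j u) x)]

end LeviCivita

end IsImmersedChart

/-! ### Covariant derivatives of tensors -/

section TensorCalculus

variable {u V : Plane → C2} {x : Plane}

theorem sum_metricInv_mul_mul_metric (hg : (metric u x).det ≠ 0) (a : Fin 2 → ℝ) (k : Fin 2) :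
    ∑ i, ∑ j, metricInv u x i j * (a i * metric u x j k) = a k := by
  have h := congrFun (Matrix.vecMul_vecMul a (metricInv u x) (metric u x)) k
  rw [metricInv_mul_metric hg, Matrix.vecMul_one] at h
  rw [← h]
  simp only [Matrix.vecMul, dotProduct, Finset.sum_mul]
  rw [Finset.sum_comm]
  exact Finset.sum_congr rfl fun j _ => Finset.sum_congr rfl fun i _ => by ring

theorem sum_metricInv_mul_metric (hg : (metric u x).det ≠ 0) :
    ∑ i, ∑ j, metricInv u x i j * metric u x i j = 2 := by
  have h := congrArg Matrix.trace (metricInv_mul_metric hg)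
  rw [Matrix.trace_one, Fintype.card_fin] at h
  simp only [Matrix.trace, Matrix.diag, Matrix.mul_apply, (metric_isSymm u x).apply] at h
  exact_mod_cast h

/-- The one-form `⟨V, ·⟩` on the surface, for a `ℂ²`-valued field `V`, not necessarily tangent. -/
noncomputable def flat (u : Plane → C2) (V : Plane → C2) (i : Fin 2) (y : Plane) : ℝ :=
  inner ℝ (V y) (pd i u y)

theorem covDerivTensor_congr {U : Set Plane} (hU : IsOpen U) (hx : x ∈ U)
    {S T : Fin 2 → Fin 2 → Plane → ℝ} (h : ∀ i j, Set.EqOn (S i j) (T i j) U) (i j k : Fin 2) :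
    covDerivTensor u S i j k x = covDerivTensor u T i j k x := by
  simp only [covDerivTensor, pd_congr hU hx (h j k), h _ _ hx]

namespace IsImmersedChart

variable {U : Set Plane} {θ : Fin 2 → Plane → ℝ} {S T : Fin 2 → Fin 2 → Plane → ℝ}
  (hu : IsImmersedChart u U)

include hu

theorem contDiffOn_flat (hV : ContDiffOn ℝ ∞ V U) (i : Fin 2) : ContDiffOn ℝ ∞ (flat u V i) U :=
  hV.inner ℝ (hu.contDiffOn_pd i)

variable (hx : x ∈ U)

include hx

theorem pd_metricInv_mul_metric (k : Fin 2) :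
    (Matrix.of fun i j => pd k (fun y => metricInv u y i j) x) * metric u x
      + metricInv u x * (Matrix.of fun i j => pd k (fun y => metric u y i j) x) = 0 := by
  ext i j
  have hconst : Set.EqOn (fun y => ∑ l, metricInv u y i l * metric u y l j)
      (fun _ => (1 : Matrix (Fin 2) (Fin 2) ℝ) i j) U := fun y hy => by
    simp only [← Matrix.mul_apply, metricInv_mul_metric (hu.det_metric_ne_zero hy)]
  have h := pd_congr hu.isOpen hx hconst k
  rw [pd_const, pd_sum_mul (fun l _ => hu.differentiableAt hx (hu.contDiffOn_metricInv i l))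
    (fun l _ => hu.differentiableAt hx (hu.contDiffOn_metric l j)), Finset.sum_add_distrib] at h
  exact h

theorem pd_metricInv (k i j : Fin 2) : pd k (fun y => metricInv u y i j) x
    = -(∑ l, christoffel u i k l x * metricInv u x l j
      + ∑ l, christoffel u j k l x * metricInv u x i l) := by
  set g := metric u x
  set h := metricInv u x
  set Γ : Matrix (Fin 2) (Fin 2) ℝ := Matrix.of fun a b => christoffel u a k b x
  set dg : Matrix (Fin 2) (Fin 2) ℝ := Matrix.of fun i j => pd k (fun y => metric u y i j) x
  set dh : Matrix (Fin 2) (Fin 2) ℝ := Matrix.of fun i j => pd k (fun y => metricInv u y i j) x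
  have hdg : dg = Γᵀ * g + g * Γ := by
    ext a b
    simp only [dg, Matrix.of_apply, hu.pd_metric_eq_christoffel hx, Matrix.add_apply,
      Matrix.mul_apply, Matrix.transpose_apply, Γ, g]
    congr 1
    exact Finset.sum_congr rfl fun l _ => by rw [mul_comm, (metric_isSymm u x).apply]
  have hgh : g * h = 1 := metric_mul_metricInv (hu.det_metric_ne_zero hx)
  have hhg : h * g = 1 := metricInv_mul_metric (hu.det_metric_ne_zero hx)
  have hdh : dh = -(Γ * h + h * Γᵀ) := calc
    dh = dh * g * h := by rw [Matrix.mul_assoc, hgh, Matrix.mul_one]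
    _ = -(h * dg) * h := by rw [eq_neg_of_add_eq_zero_left (hu.pd_metricInv_mul_metric hx k)]
    _ = -(h * Γᵀ * (g * h) + h * g * Γ * h) := by rw [hdg]; noncomm_ring
    _ = -(Γ * h + h * Γᵀ) := by rw [hgh, hhg, Matrix.mul_one, Matrix.one_mul, add_comm]
  have hdh_apply := congrFun₂ hdh i j
  simp only [Matrix.neg_apply, Matrix.add_apply, Matrix.mul_apply, Matrix.transpose_apply]
    at hdh_apply
  simp only [dh, Γ, Matrix.of_apply, mul_comm (h i _)] at hdh_apply
  exact hdh_apply

theorem covDerivTensor_symm (hS : ∀ j k, Set.EqOn (S j k) (S k j) U) (i j k : Fin 2) :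
    covDerivTensor u S i j k x = covDerivTensor u S i k j x := by
  simp only [covDerivTensor, pd_congr hu.isOpen hx (hS j k) i, hS _ j hx, hS k _ hx]
  ring

theorem pd_trace (hS : ∀ i j, ContDiffOn ℝ ∞ (S i j) U) (k : Fin 2) :
    pd k (fun y => ∑ i, ∑ j, metricInv u y i j * S i j y) x
      = ∑ i, ∑ j, metricInv u x i j * covDerivTensor u S k i j x := by
  have hh : ∀ i j, DifferentiableAt ℝ (fun y => metricInv u y i j) x := fun i j =>
    hu.differentiableAt hx (hu.contDiffOn_metricInv i j)
  have hSx : ∀ i j, DifferentiableAt ℝ (S i j) x := fun i j => hu.differentiableAt hx (hS i j)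
  rw [pd_sum fun i _ => DifferentiableAt.fun_sum fun j _ => (hh i j).fun_mul (hSx i j)]
  have pd_row : ∀ i, pd k (fun y => ∑ j, metricInv u y i j * S i j y) x
      = ∑ j, (pd k (fun y => metricInv u y i j) x * S i j x + metricInv u x i j * pd k (S i j) x) :=
    fun i => pd_sum_mul (fun j _ => hh i j) (fun j _ => hSx i j) k
  simp only [pd_row]
  simp only [hu.pd_metricInv hx, covDerivTensor, Fin.sum_univ_two]
  ring

theorem adjointDeriv_sub (hS : ∀ i j, ContDiffOn ℝ ∞ (S i j) U)
    (hT : ∀ i j, ContDiffOn ℝ ∞ (T i j) U) (k : Fin 2) :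
    adjointDeriv u (fun i j y => S i j y - T i j y) k x
      = adjointDeriv u S k x - adjointDeriv u T k x := by
  have covDerivTensor_sub : ∀ i j, covDerivTensor u (fun i j y => S i j y - T i j y) i j k x
      = covDerivTensor u S i j k x - covDerivTensor u T i j k x := fun i j => by
    simp only [covDerivTensor, pd_sub (hu.differentiableAt hx (hS j k))
      (hu.differentiableAt hx (hT j k)), mul_sub, Finset.sum_sub_distrib]
    ring
  simp only [adjointDeriv, covDerivTensor_sub, mul_sub, Finset.sum_sub_distrib]
  ring

theorem covDerivTensor_mul_metric {c : Plane → ℝ} (hc : ContDiffOn ℝ ∞ c U) (i j k : Fin 2) :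
    covDerivTensor u (fun j k y => c y * metric u y j k) i j k x = pd i c x * metric u x j k := by
  simp only [covDerivTensor, pd_mul (hu.differentiableAt hx hc)
    (hu.differentiableAt hx (hu.contDiffOn_metric j k)), hu.pd_metric_eq_christoffel hx,
    (metric_isSymm u x).apply _ j, Fin.sum_univ_two]
  ring

theorem adjointDeriv_mul_metric {c : Plane → ℝ} (hc : ContDiffOn ℝ ∞ c U) (k : Fin 2) :
    adjointDeriv u (fun j k y => c y * metric u y j k) k x = -pd k c x := by
  simp only [adjointDeriv, hu.covDerivTensor_mul_metric hx hc,
    sum_metricInv_mul_mul_metric (hu.det_metric_ne_zero hx)]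

theorem pd_flat (hV : ContDiffOn ℝ ∞ V U) (i j : Fin 2) :
    pd i (flat u V j) x = inner ℝ (pd i V x) (pd j u x) + inner ℝ (V x) (secondFF u i j x)
      + ∑ k, christoffel u k i j x * flat u V k x := by
  have h : pd i (flat u V j) x = inner ℝ (pd i V x) (pd j u x)
      + inner ℝ (V x) (pd i (pd j u) x) :=
    pd_inner (hu.differentiableAt hx hV) (hu.differentiableAt hx (hu.contDiffOn_pd j)) i
  rw [h, hu.pd_pd_eq_secondFF_add hx]
  simp only [inner_add_right, inner_sum, real_inner_smul_right, flat]
  ring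

theorem covDerivForm_flat (hV : ContDiffOn ℝ ∞ V U) (i j : Fin 2) :
    covDerivForm u (flat u V) i j x
      = inner ℝ (pd i V x) (pd j u x) + inner ℝ (V x) (secondFF u i j x) := by
  rw [covDerivForm, hu.pd_flat hx hV, add_sub_cancel_right]

theorem divergence_eq_trace (hV : ContDiffOn ℝ ∞ V U) :
    divergence u V x = ∑ i, ∑ j, metricInv u x i j * covDerivForm u (flat u V) i j x := by
  have hh : ∀ i j, DifferentiableAt ℝ (fun y => metricInv u y i j) x := fun i j =>
    hu.differentiableAt hx (hu.contDiffOn_metricInv i j)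
  have hθ : ∀ j, DifferentiableAt ℝ (flat u V j) x := fun j =>
    hu.differentiableAt hx (hu.contDiffOn_flat hV j)
  have hcomp : ∀ y i, tangComp u y (V y) i = ∑ j, metricInv u y i j * flat u V j y :=
    fun y i => rfl
  have pd_comp : ∀ i, pd i (fun y => ∑ j, metricInv u y i j * flat u V j y) x
      = ∑ j, (pd i (fun y => metricInv u y i j) x * flat u V j x
        + metricInv u x i j * pd i (flat u V j) x) :=
    fun i => pd_sum_mul (fun j _ => hh i j) (fun j _ => hθ j) i
  simp only [divergence, hcomp, pd_comp]
  simp only [covDerivForm, hu.pd_metricInv hx, Fin.sum_univ_two]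
  ring

omit hx in
theorem contDiffOn_divergence (hV : ContDiffOn ℝ ∞ V U) : ContDiffOn ℝ ∞ (divergence u V) U :=
  (hu.contDiffOn_sum_metricInv_mul fun i j =>
    hu.contDiffOn_covDerivForm (hu.contDiffOn_flat hV) i j).congr
    fun _ hy => hu.divergence_eq_trace hy hV

end IsImmersedChart

end TensorCalculus

/-! ### Curvature -/

section Curvature

variable {u V : Plane → C2} {x : Plane}

/-- The Gauss curvature of the surface, given by the Gauss equation as
`(⟨A₀₀, A₁₁⟩ - |A₀₁|²) / det g`. -/
noncomputable def gaussCurvature (u : Plane → C2) (x : Plane) : ℝ :=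
  (inner ℝ (secondFF u 0 0 x) (secondFF u 1 1 x) - ‖secondFF u 0 1 x‖ ^ 2) / (metric u x).det

theorem inner_meanCurv (u : Plane → C2) (x : Plane) (N : C2) : inner ℝ N (meanCurv u x)
    = ∑ i, ∑ j, metricInv u x i j * inner ℝ N (secondFF u i j x) := by
  simp only [meanCurv, inner_sum, real_inner_smul_right]

namespace IsImmersedChart

variable {U : Set Plane} (hu : IsImmersedChart u U) (hx : x ∈ U)

include hu hx

theorem inner_secondFF_sub_inner_secondFF (i j k l : Fin 2) :
    inner ℝ (secondFF u i j x) (secondFF u k l x) - inner ℝ (secondFF u i l x) (secondFF u k j x)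
      = gaussCurvature u x
        * (metric u x i j * metric u x k l - metric u x i l * metric u x k j) := by
  have hdet : gaussCurvature u x * (metric u x 0 0 * metric u x 1 1 - metric u x 0 1 ^ 2)
      = inner ℝ (secondFF u 0 0 x) (secondFF u 1 1 x)
        - inner ℝ (secondFF u 0 1 x) (secondFF u 0 1 x) := by
    rw [real_inner_self_eq_norm_sq, gaussCurvature,
      div_mul_eq_mul_div, div_eq_iff (hu.det_metric_ne_zero hx), Matrix.det_fin_two,
      (metric_isSymm u x).apply 0 1, sq (metric u x 0 1)]
  have hA := hu.secondFF_symm hx 1 0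
  have hg := (metric_isSymm u x).apply 0 1
  revert i j k l
  simp only [Fin.forall_fin_two, hA, hg, real_inner_comm (secondFF u 0 0 x),
    real_inner_comm (secondFF u 0 1 x) (secondFF u 1 1 x)]
  and_intros <;> linarith

theorem ricci_eq_gaussCurvature_mul_metric (k l : Fin 2) :
    ∑ i, ∑ j, metricInv u x i j * (inner ℝ (secondFF u i j x) (secondFF u k l x)
        - inner ℝ (secondFF u i l x) (secondFF u k j x))
      = gaussCurvature u x * metric u x k l := by
  have hg := hu.det_metric_ne_zero hx
  have hlower : ∑ i, ∑ j, metricInv u x i j * (metric u x i l * metric u x k j)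
      = metric u x k l := by
    simp only [← (metric_isSymm u x).apply k, sum_metricInv_mul_mul_metric hg]
  have hsplit : ∀ i j, metricInv u x i j * (gaussCurvature u x
        * (metric u x i j * metric u x k l - metric u x i l * metric u x k j))
      = gaussCurvature u x * (metric u x k l * (metricInv u x i j * metric u x i j)
        - metricInv u x i j * (metric u x i l * metric u x k j)) :=
    fun i j => by ring
  simp only [hu.inner_secondFF_sub_inner_secondFF hx, hsplit, ← Finset.mul_sum,
    Finset.sum_sub_distrib, hlower, sum_metricInv_mul_metric hg]
  ring

theorem norm_meanCurv_sq_sub_normSqTensor :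
    ‖meanCurv u x‖ ^ 2 - normSqTensor u (secondFF u) x = 2 * gaussCurvature u x := by
  have hnorm : ‖meanCurv u x‖ ^ 2 = ∑ k, ∑ l, metricInv u x k l * ∑ i, ∑ j,
      metricInv u x i j * inner ℝ (secondFF u i j x) (secondFF u k l x) := by
    rw [← real_inner_self_eq_norm_sq, inner_meanCurv]
    simp only [meanCurv, sum_inner, real_inner_smul_left]
  have hnormSq : normSqTensor u (secondFF u) x = ∑ k, ∑ l, metricInv u x k l * ∑ i, ∑ j,
      metricInv u x i j * inner ℝ (secondFF u i l x) (secondFF u k j x) := by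
    simp only [normSqTensor, Fin.sum_univ_two, hu.secondFF_symm hx 1 0,
      (metricInv_isSymm u x).apply 0 1, real_inner_comm (secondFF u 0 0 x),
      real_inner_comm (secondFF u 0 1 x) (secondFF u 1 1 x)]
    ring
  have htrace : ∑ k, ∑ l, metricInv u x k l * (gaussCurvature u x * metric u x k l)
      = 2 * gaussCurvature u x := by
    simp only [mul_left_comm _ (gaussCurvature u x), ← Finset.mul_sum,
      sum_metricInv_mul_metric (hu.det_metric_ne_zero hx)]
    ring
  rw [← htrace, hnorm, hnormSq]
  simp only [← hu.ricci_eq_gaussCurvature_mul_metric hx, mul_sub, Finset.sum_sub_distrib]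

/-! ### The Bochner formula for tangent fields -/

theorem inner_pd_of_isTangent (hV : ContDiffOn ℝ ∞ V U) (hT : ∀ y ∈ U, IsTangent u y (V y))
    {N : C2} (hN : IsNormal u x N) (i : Fin 2) : inner ℝ (pd i V x) N
      = ∑ l, tangComp u x (V x) l * inner ℝ (secondFF u i l x) N := by
  have hcomp : ∀ l, DifferentiableAt ℝ (fun y => tangComp u y (V y) l) x := fun l =>
    hu.differentiableAt hx (hu.contDiffOn_tangComp hV l)
  have hpd : ∀ l, DifferentiableAt ℝ (pd l u) x := fun l =>
    hu.differentiableAt hx (hu.contDiffOn_pd l)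
  have hexp : Set.EqOn V (fun y => ∑ l, tangComp u y (V y) l • pd l u y) U := fun y hy =>
    (hT y hy).symm
  rw [pd_congr hu.isOpen hx hexp, pd_sum fun l _ => (hcomp l).fun_smul (hpd l), sum_inner]
  refine Finset.sum_congr rfl fun l _ => ?_
  rw [pd_smul (hcomp l) (hpd l), inner_add_left, real_inner_smul_left, real_inner_smul_left,
    real_inner_comm, hN l, mul_zero, zero_add, secondFF, hN.inner_normalPart]

theorem covDerivTensor_covDerivForm_flat (hV : ContDiffOn ℝ ∞ V U)
    (hT : ∀ y ∈ U, IsTangent u y (V y)) (i k j : Fin 2) :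
    covDerivTensor u (covDerivForm u (flat u V)) i k j x
      = inner ℝ (pd i (pd k V) x) (pd j u x) + inner ℝ (pd k V x) (secondFF u i j x)
        - ∑ l, christoffel u l i k x * inner ℝ (pd l V x) (pd j u x) := by
  have hcov : ∀ k j, Set.EqOn (covDerivForm u (flat u V) k j) (flat u (pd k V) j) U :=
    fun k j y hy => by
      rw [hu.covDerivForm_flat hy hV,
        (hT y hy).inner_eq_zero (isNormal_secondFF (hu.det_metric_ne_zero hy) k j), add_zero, flat]
  rw [covDerivTensor_congr hu.isOpen hx hcov]
  simp only [covDerivTensor, hu.pd_flat hx (LagrangianSurface.contDiffOn_pd hu.isOpen hV k)]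
  simp only [flat]
  ring

theorem ricci_identity (hV : ContDiffOn ℝ ∞ V U) (hT : ∀ y ∈ U, IsTangent u y (V y))
    (i k j : Fin 2) :
    covDerivTensor u (covDerivForm u (flat u V)) i k j x
        - covDerivTensor u (covDerivForm u (flat u V)) k i j x
      = ∑ l, tangComp u x (V x) l * (inner ℝ (secondFF u i j x) (secondFF u k l x)
        - inner ℝ (secondFF u i l x) (secondFF u k j x)) := by
  have hg := hu.det_metric_ne_zero hx
  rw [hu.covDerivTensor_covDerivForm_flat hx hV hT, hu.covDerivTensor_covDerivForm_flat hx hV hT,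
    pd_comm hu.isOpen hx hV k i, hu.inner_pd_of_isTangent hx hV hT (isNormal_secondFF hg i j),
    hu.inner_pd_of_isTangent hx hV hT (isNormal_secondFF hg k j)]
  simp only [hu.christoffel_symm hx _ k i, mul_sub, Finset.sum_sub_distrib,
    real_inner_comm (secondFF u i j x)]
  ring

theorem neg_adjointDeriv_covDerivForm_flat (hV : ContDiffOn ℝ ∞ V U)
    (hT : ∀ y ∈ U, IsTangent u y (V y))
    (hsymm : ∀ i j, Set.EqOn (covDerivForm u (flat u V) i j) (covDerivForm u (flat u V) j i) U)
    (k : Fin 2) :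
    -adjointDeriv u (covDerivForm u (flat u V)) k x
      = pd k (divergence u V) x + gaussCurvature u x * flat u V k x := by
  have hdiv : pd k (divergence u V) x = ∑ i, ∑ j,
      metricInv u x i j * covDerivTensor u (covDerivForm u (flat u V)) k i j x := by
    rw [← hu.pd_trace hx fun i j => hu.contDiffOn_covDerivForm (hu.contDiffOn_flat hV) i j]
    exact pd_congr hu.isOpen hx (fun y hy => hu.divergence_eq_trace hy hV) k
  have hcommute : ∀ i j, covDerivTensor u (covDerivForm u (flat u V)) i j k x
      = covDerivTensor u (covDerivForm u (flat u V)) k i j x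
        + ∑ l, tangComp u x (V x) l * (inner ℝ (secondFF u i j x) (secondFF u k l x)
        - inner ℝ (secondFF u i l x) (secondFF u k j x)) := fun i j => by
    rw [hu.covDerivTensor_symm hx hsymm, ← hu.ricci_identity hx hV hT, add_sub_cancel]
  have hricci : ∑ i, ∑ j, metricInv u x i j * ∑ l, tangComp u x (V x) l *
        (inner ℝ (secondFF u i j x) (secondFF u k l x)
          - inner ℝ (secondFF u i l x) (secondFF u k j x))
      = gaussCurvature u x * flat u V k x := by
    have hlower : flat u V k x = ∑ l, tangComp u x (V x) l * metric u x k l := by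
      simp only [flat, ← sum_tangComp_mul_metric (hu.det_metric_ne_zero hx),
        (metric_isSymm u x).apply]
    simp only [hlower, Finset.mul_sum, mul_left_comm (gaussCurvature u x),
      ← hu.ricci_eq_gaussCurvature_mul_metric hx]
    simp only [Fin.sum_univ_two]
    ring
  simp only [adjointDeriv, neg_neg, hcommute, mul_add, Finset.sum_add_distrib, hdiv, hricci]

end IsImmersedChart

end Curvature

/-! ### Lagrangian charts -/

/-- A smooth immersion of the open subset `U` of the parameter plane whose image is Lagrangian. -/
structure IsLagrangianChart (u : Plane → C2) (U : Set Plane) : Prop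
    extends IsImmersedChart u U where
  omega_pd : ∀ ⦃y⦄, y ∈ U → ∀ i j, omega (pd i u y) (pd j u y) = 0

/-- The complex matrix whose columns are the coordinate vectors `∂₀ u, ∂₁ u` of the surface. -/
noncomputable def frameMatrix (u : Plane → C2) (y : Plane) : Matrix (Fin 2) (Fin 2) ℂ :=
  Matrix.of fun r k => pd k u y r

theorem contract_eq_flat (u φ : Plane → C2) : contract u φ = flat u fun y => J (φ y) :=
  funext₂ fun _ _ => omega_eq_inner _ _

theorem contract_apply (u φ : Plane → C2) (i : Fin 2) (y : Plane) :
    contract u φ i y = inner ℝ (J (φ y)) (pd i u y) := omega_eq_inner _ _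

namespace IsLagrangianChart

section Frame

variable {u : Plane → C2} {U : Set Plane} {x : Plane} (hu : IsLagrangianChart u U) (hx : x ∈ U)
  {N V W : C2}

include hu hx

theorem isNormal_J_pd (i : Fin 2) : IsNormal u x (J (pd i u x)) := fun j => by
  rw [← omega_eq_inner, hu.omega_pd hx]

theorem conjTranspose_frameMatrix_mul_self :
    (frameMatrix u x)ᴴ * frameMatrix u x = (metric u x).map (algebraMap ℝ ℂ) := by
  ext i j
  have h := inner_complex_eq (pd i u x) (pd j u x)
  rw [hu.isNormal_J_pd hx i j, PiLp.inner_apply] at h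
  simpa [Matrix.mul_apply, frameMatrix, metric_apply, mul_comm] using h

theorem det_frameMatrix_ne_zero : (frameMatrix u x).det ≠ 0 := fun h => by
  have hdet := congrArg Matrix.det (hu.conjTranspose_frameMatrix_mul_self hx)
  rw [Matrix.det_mul, h, mul_zero, ← RingHom.mapMatrix_apply, ← RingHom.map_det] at hdet
  exact hu.det_metric_ne_zero hx ((map_eq_zero _).1 hdet.symm)

theorem eq_of_inner_eq (htan : ∀ i, inner ℝ V (pd i u x) = inner ℝ W (pd i u x))
    (hnor : ∀ i, inner ℝ V (J (pd i u x)) = inner ℝ W (J (pd i u x))) : V = W := by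
  have hdet : ((frameMatrix u x)ᴴ).det ≠ 0 := by
    simpa [Matrix.det_conjTranspose] using hu.det_frameMatrix_ne_zero hx
  have hker : (frameMatrix u x)ᴴ *ᵥ (V - W).ofLp = 0 := funext fun i => by
    have hre : inner ℝ (pd i u x) (V - W) = 0 := by
      rw [real_inner_comm, inner_sub_left, htan, sub_self]
    have him : inner ℝ (J (pd i u x)) (V - W) = 0 := by
      rw [real_inner_comm, inner_sub_left, hnor, sub_self]
    have h := inner_complex_eq (pd i u x) (V - W)
    rw [hre, him, PiLp.inner_apply] at h
    simpa [Matrix.mulVec, dotProduct, frameMatrix, mul_comm] using h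
  have hzero := Matrix.eq_zero_of_mulVec_eq_zero hdet hker
  exact sub_eq_zero.1 (by ext k; exact congrFun hzero k)

theorem isTangent_J (hN : IsNormal u x N) : IsTangent u x (J N) := by
  refine hu.eq_of_inner_eq hx (fun k => ?_) fun k => ?_
  · simp only [sum_inner, real_inner_smul_left, ← metric_apply,
      sum_tangComp_mul_metric (hu.det_metric_ne_zero hx)]
  · rw [inner_J_J, hN k, real_inner_comm]
    simp only [inner_sum, real_inner_smul_right, hu.isNormal_J_pd hx k _, mul_zero,
      Finset.sum_const_zero]

theorem sum_tangComp_smul_J_pd (hN : IsNormal u x N) :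
    ∑ i, tangComp u x (J N) i • J (pd i u x) = -N := by
  simpa only [J_sum, J_smul, J_J] using congrArg J (hu.isTangent_J hx hN)

end Frame

section NormalFields

variable {u φ : Plane → C2} {U : Set Plane} {x : Plane} (hu : IsLagrangianChart u U) (hx : x ∈ U)

include hu hx

theorem inner_secondFF_J_pd_symm (i j k : Fin 2) :
    inner ℝ (secondFF u i j x) (J (pd k u x)) = inner ℝ (secondFF u i k x) (J (pd j u x)) := by
  have hpd : ∀ j, DifferentiableAt ℝ (pd j u) x := fun j =>
    hu.differentiableAt hx (hu.contDiffOn_pd j)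
  have hJpd : DifferentiableAt ℝ (fun y => J (pd j u y)) x :=
    hu.differentiableAt hx (contDiffOn_J (hu.contDiffOn_pd j))
  have hlag : Set.EqOn (fun y => inner ℝ (J (pd j u y)) (pd k u y)) (fun _ => 0) U :=
    fun y hy => hu.isNormal_J_pd hy j k
  have h := pd_congr hu.isOpen hx hlag i
  rw [pd_const, pd_inner hJpd (hpd k), pd_J (hpd j), inner_J_left,
    real_inner_comm _ (J (pd j u x))] at h
  rw [secondFF, (hu.isNormal_J_pd hx k).inner_normalPart, secondFF,
    (hu.isNormal_J_pd hx j).inner_normalPart]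
  linarith

theorem covDerivForm_contract (hφ : ContDiffOn ℝ ∞ φ U) (hN : IsNormal u x (φ x)) (i j : Fin 2) :
    covDerivForm u (contract u φ) i j x = contract u (normalDeriv u φ i) j x := by
  have hA := isNormal_secondFF (hu.det_metric_ne_zero hx) i j
  rw [contract_eq_flat, hu.covDerivForm_flat hx (contDiffOn_J hφ),
    (hu.isTangent_J hx hN).inner_eq_zero hA, add_zero, pd_J (hu.differentiableAt hx hφ),
    contract_apply, inner_J_left, inner_J_left, normalDeriv,
    (hu.isNormal_J_pd hx j).inner_normalPart]

theorem covDerivTensor_contract {θ : Fin 2 → Plane → C2} (hθ : ∀ j, ContDiffOn ℝ ∞ (θ j) U)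
    (hN : ∀ j, IsNormal u x (θ j x)) (i j k : Fin 2) :
    covDerivTensor u (fun a b => contract u (θ a) b) i j k x
      = contract u (normalDerivForm u θ i j) k x := by
  have h := hu.covDerivForm_contract hx (hθ j) (hN j) i k
  rw [covDerivForm] at h
  rw [covDerivTensor, sub_right_comm, h]
  simp only [contract_apply, normalDeriv, normalDerivForm, J_sub, J_smul, J_sum, inner_sub_left,
    real_inner_smul_left, sum_inner]

theorem contract_normalLaplacian (hφ : ContDiffOn ℝ ∞ φ U) (hN : ∀ y ∈ U, IsNormal u y (φ y))
    (k : Fin 2) : contract u (normalLaplacian u φ) k x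
      = -adjointDeriv u (covDerivForm u (contract u φ)) k x := by
  have hcov : ∀ i j, Set.EqOn (covDerivForm u (contract u φ) i j)
      (contract u (normalDeriv u φ i) j) U := fun i j y hy =>
    hu.covDerivForm_contract hy hφ (hN y hy) i j
  have hnor : ∀ j, IsNormal u x (normalDeriv u φ j x) := fun j =>
    isNormal_normalPart (hu.det_metric_ne_zero hx) _
  rw [adjointDeriv, neg_neg]
  simp only [covDerivTensor_congr hu.isOpen hx hcov,
    hu.covDerivTensor_contract hx (hu.contDiffOn_normalDeriv hφ) hnor]
  simp only [contract_apply, normalLaplacian, J_sum, J_smul, sum_inner, real_inner_smul_left]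

end NormalFields

end IsLagrangianChart

/-! ### The Lagrangian angle and the closedness of `H ⌟ ω` -/

section LagrangianAngle

theorem pd_det_of_pd_eq_mul {M : Plane → Matrix (Fin 2) (Fin 2) ℂ} {B : Matrix (Fin 2) (Fin 2) ℂ}
    {x : Plane} {j : Fin 2} (hM : ∀ r k, DifferentiableAt ℝ (fun y => M y r k) x)
    (h : ∀ r k, pd j (fun y => M y r k) x = (M x * B) r k) :
    pd j (fun y => (M y).det) x = B.trace * (M x).det := by
  simp only [Matrix.det_fin_two, Matrix.trace_fin_two]
  rw [pd_sub ((hM 0 0).fun_mul (hM 1 1)) ((hM 0 1).fun_mul (hM 1 0)), pd_mul (hM 0 0) (hM 1 1),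
    pd_mul (hM 0 1) (hM 1 0)]
  simp only [h, Matrix.mul_apply, Fin.sum_univ_two]
  ring

namespace IsLagrangianChart

variable {u : Plane → C2} {U : Set Plane} {x : Plane} (hu : IsLagrangianChart u U)

include hu

theorem contDiffOn_frameMatrix (r k : Fin 2) : ContDiffOn ℝ ∞ (fun y => frameMatrix u y r k) U :=
  ((EuclideanSpace.proj (𝕜 := ℂ) r).restrictScalars ℝ).contDiff.comp_contDiffOn (hu.contDiffOn_pd k)

theorem contDiffOn_det_frameMatrix : ContDiffOn ℝ ∞ (fun y => (frameMatrix u y).det) U := by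
  simp only [Matrix.det_fin_two]
  exact ((hu.contDiffOn_frameMatrix 0 0).mul (hu.contDiffOn_frameMatrix 1 1)).sub
    ((hu.contDiffOn_frameMatrix 0 1).mul (hu.contDiffOn_frameMatrix 1 0))

variable (hx : x ∈ U)

include hx

theorem sum_tangComp_J_secondFF (j : Fin 2) :
    ∑ k, tangComp u x (J (secondFF u j k x)) k = contract u (meanCurv u) j x := by
  rw [contract_apply, inner_J_left, real_inner_comm, inner_meanCurv, ← Finset.sum_neg_distrib]
  refine Finset.sum_congr rfl fun k _ => ?_
  rw [tangComp, ← Finset.sum_neg_distrib]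
  refine Finset.sum_congr rfl fun m _ => ?_
  rw [inner_J_left, hu.secondFF_symm hx, hu.inner_secondFF_J_pd_symm hx, real_inner_comm, mul_neg]

theorem pd_frameMatrix (j r k : Fin 2) : pd j (fun y => frameMatrix u y r k) x
    = (frameMatrix u x * Matrix.of fun l k => (christoffel u l j k x : ℂ)
      - tangComp u x (J (secondFF u j k x)) l * Complex.I) r k := by
  have hnormal := hu.sum_tangComp_smul_J_pd hx (isNormal_secondFF (hu.det_metric_ne_zero hx) j k)
  have hpd : pd j (pd k u) x = ∑ l, christoffel u l j k x • pd l u x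
      - ∑ l, tangComp u x (J (secondFF u j k x)) l • J (pd l u x) := by
    rw [hu.pd_pd_eq_secondFF_add hx, hnormal, sub_neg_eq_add, add_comm]
  have hproj : pd j (fun y => frameMatrix u y r k) x = pd j (pd k u) x r :=
    pd_clm_comp ((EuclideanSpace.proj (𝕜 := ℂ) r).restrictScalars ℝ)
      (hu.differentiableAt hx (hu.contDiffOn_pd k)) j
  rw [hproj, hpd]
  simp only [J, frameMatrix, Matrix.mul_apply, Matrix.of_apply, Fin.sum_univ_two, PiLp.sub_apply,
    PiLp.add_apply, PiLp.smul_apply, Complex.real_smul, smul_eq_mul]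
  ring

theorem pd_det_frameMatrix (j : Fin 2) : pd j (fun y => (frameMatrix u y).det) x
    = ((∑ k, christoffel u k j k x : ℝ) - contract u (meanCurv u) j x * Complex.I)
      * (frameMatrix u x).det := by
  rw [pd_det_of_pd_eq_mul
    (fun r k => hu.differentiableAt hx (hu.contDiffOn_frameMatrix r k)) (hu.pd_frameMatrix hx j),
    ← hu.sum_tangComp_J_secondFF hx]
  simp only [Matrix.trace, Matrix.diag, Matrix.of_apply, Finset.sum_sub_distrib, Complex.ofReal_sum,
    Finset.sum_mul]

theorem pd_contract_meanCurv_comm (i j : Fin 2) :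
    pd i (contract u (meanCurv u) j) x = pd j (contract u (meanCurv u) i) x := by
  set w : Fin 2 → Plane → ℂ := fun j y =>
    (∑ k, christoffel u k j k y : ℝ) - contract u (meanCurv u) j y * Complex.I
  have hw : ∀ j, DifferentiableAt ℝ (w j) x := fun j => by
    have hα : ContDiffOn ℝ ∞ (contract u (meanCurv u) j) U := by
      rw [contract_eq_flat]
      exact hu.contDiffOn_flat (contDiffOn_J hu.contDiffOn_meanCurv) j
    have hΓ : ContDiffOn ℝ ∞ (fun y => ∑ k, christoffel u k j k y) U :=
      ContDiffOn.sum fun k _ => hu.contDiffOn_christoffel k j k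
    exact (Complex.ofRealCLM.differentiableAt.comp x (hu.differentiableAt hx hΓ)).sub
      ((Complex.ofRealCLM.differentiableAt.comp x (hu.differentiableAt hx hα)).mul_const _)
  have hcomm := pd_comm_of_pd_eq_mul hu.isOpen hx hu.contDiffOn_det_frameMatrix
    (hu.det_frameMatrix_ne_zero hx) hw (fun j y hy => hu.pd_det_frameMatrix hy j) i j
  have him : ∀ i j, pd i (contract u (meanCurv u) j) x = (-Complex.imCLM) (pd i (w j) x) :=
    fun i j => by
      rw [← pd_clm_comp (-Complex.imCLM) (hw j) i]
      simp [w]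
  rw [him, him, hcomm]

theorem covDerivForm_contract_meanCurv_symm (i j : Fin 2) :
    covDerivForm u (contract u (meanCurv u)) i j x
      = covDerivForm u (contract u (meanCurv u)) j i x := by
  simp only [covDerivForm, hu.pd_contract_meanCurv_comm hx i j, hu.christoffel_symm hx _ i j]

end IsLagrangianChart

end LagrangianAngle

/-! ### The algebra of `Ǎ` -/

section TensorAlgebra

/-- The full contraction `∑ s^{ij} B_{ij}` of a `ℂ²`-valued tensor `B` with a tensor `s` with upper
indices. The trace, the operator `Q(B)` and the diagonal value `B(V, V)` are all of this form. -/
noncomputable def tensorContraction :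
    Matrix (Fin 2) (Fin 2) ℝ →ₗ[ℝ] (Fin 2 → Fin 2 → C2) →ₗ[ℝ] C2 :=
  LinearMap.mk₂ ℝ (fun s B => ∑ i, ∑ j, s i j • B i j)
    (fun _ _ _ => by simp only [Matrix.add_apply, add_smul, Finset.sum_add_distrib])
    (fun _ _ _ => by simp only [Matrix.smul_apply, smul_assoc, Finset.smul_sum])
    (fun _ _ _ => by simp only [Pi.add_apply, smul_add, Finset.sum_add_distrib])
    fun c s _ => by simp only [Pi.smul_apply, smul_comm (s _ _) c, Finset.smul_sum]

theorem tensorContraction_apply (s : Matrix (Fin 2) (Fin 2) ℝ) (B : Fin 2 → Fin 2 → C2) :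
    tensorContraction s B = ∑ i, ∑ j, s i j • B i j := rfl

/-- The inner product `⟨B, C⟩ = g^{ik} g^{jl} ⟨B_{ij}, C_{kl}⟩` of `ℂ²`-valued two-tensors at `x`,
polarizing `normSqTensor`. -/
noncomputable def tensorInner (u : Plane → C2) (x : Plane) :
    (Fin 2 → Fin 2 → C2) →ₗ[ℝ] (Fin 2 → Fin 2 → C2) →ₗ[ℝ] ℝ :=
  LinearMap.mk₂ ℝ
    (fun B C => ∑ i, ∑ j, ∑ k, ∑ l, metricInv u x i k * metricInv u x j l * inner ℝ (B i j) (C k l))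
    (fun _ _ _ => by simp only [Pi.add_apply, inner_add_left, mul_add, Finset.sum_add_distrib])
    (fun _ _ _ => by
      simp only [Pi.smul_apply, real_inner_smul_left, mul_left_comm _ (_ : ℝ), Finset.mul_sum,
        smul_eq_mul])
    (fun _ _ _ => by simp only [Pi.add_apply, inner_add_right, mul_add, Finset.sum_add_distrib])
    fun _ _ _ => by
      simp only [Pi.smul_apply, real_inner_smul_right, mul_left_comm _ (_ : ℝ), Finset.mul_sum,
        smul_eq_mul]

theorem tensorInner_apply (u : Plane → C2) (x : Plane) (B C : Fin 2 → Fin 2 → C2) :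
    tensorInner u x B C = ∑ i, ∑ j, ∑ k, ∑ l,
      metricInv u x i k * metricInv u x j l * inner ℝ (B i j) (C k l) := rfl

theorem tensorInner_comm (u : Plane → C2) (x : Plane) (B C : Fin 2 → Fin 2 → C2) :
    tensorInner u x B C = tensorInner u x C B := by
  have h := (metricInv_isSymm u x).apply 0 1
  simp only [tensorInner_apply, Fin.sum_univ_two, h, real_inner_comm]
  ring

theorem tensorInner_swap (u : Plane → C2) (x : Plane) {B : Fin 2 → Fin 2 → C2}
    (hB : ∀ i j, B i j = B j i) (C : Fin 2 → Fin 2 → C2) :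
    tensorInner u x B (fun k l => C l k) = tensorInner u x B C := by
  simp only [tensorInner_apply, Fin.sum_univ_two, hB 1 0]
  ring

theorem tensorInner_smul (u : Plane → C2) (x : Plane) (B : Fin 2 → Fin 2 → C2) (θ : Fin 2 → ℝ)
    (N : Fin 2 → C2) : tensorInner u x B (fun k l => θ k • N l)
      = ∑ i, (metricInv u x *ᵥ θ) i * ∑ j, ∑ l, metricInv u x j l * inner ℝ (B i j) (N l) := by
  simp only [tensorInner_apply, real_inner_smul_right, Matrix.mulVec, dotProduct, Fin.sum_univ_two]
  ring

theorem tensorInner_metric_smul {u : Plane → C2} {x : Plane} (hg : (metric u x).det ≠ 0)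
    (B : Fin 2 → Fin 2 → C2) (N : C2) : tensorInner u x B (fun k l => metric u x k l • N)
      = inner ℝ (tensorContraction (metricInv u x) B) N := by
  simp only [tensorInner_apply, tensorContraction_apply, sum_inner, real_inner_smul_left,
    real_inner_smul_right]
  refine Finset.sum_congr rfl fun i _ => Finset.sum_congr rfl fun j _ => ?_
  have h : ∑ l, (∑ k, metricInv u x i k * metric u x k l) * metricInv u x l j
      = metricInv u x i j := by
    simp only [← Matrix.mul_apply, metricInv_mul_metric hg, Matrix.one_mul]
  rw [← h, Finset.sum_comm, Finset.sum_mul]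
  refine Finset.sum_congr rfl fun l _ => ?_
  rw [Finset.sum_mul, Finset.sum_mul, (metricInv_isSymm u x).apply j l]
  exact Finset.sum_congr rfl fun k _ => by ring

/-- The pure trace tensor `⟨v, w⟩ H + ⟨J v, H⟩ J w + ⟨J w, H⟩ J v`, a quarter of which is removed
from `A` to obtain `Ǎ`. -/
noncomputable def lagrangianTrace (u : Plane → C2) (x : Plane) (i j : Fin 2) : C2 :=
  metric u x i j • meanCurv u x + (inner ℝ (J (pd i u x)) (meanCurv u x) : ℝ) • J (pd j u x)
    + (inner ℝ (J (pd j u x)) (meanCurv u x) : ℝ) • J (pd i u x)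

/-- The second fundamental form `⟨A(·, ·), N⟩` in the direction of a normal vector `N`. -/
noncomputable def secondFFAlong (u : Plane → C2) (x : Plane) (N : C2) :
    Matrix (Fin 2) (Fin 2) ℝ :=
  Matrix.of fun i j => inner ℝ (secondFF u i j x) N

variable (u : Plane → C2) (x : Plane)

theorem checkA_eq_sub : (checkA u · · x)
    = (secondFF u · · x) - (1 / 4 : ℝ) • lagrangianTrace u x := rfl

theorem tracefreeA_eq_sub : (tracefreeA u · · x)
    = (secondFF u · · x) - (1 / 2 : ℝ) • fun i j => metric u x i j • meanCurv u x :=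
  funext₂ fun _ _ => congrArg _ (mul_smul _ _ _)

theorem meanCurv_eq_tensorContraction :
    meanCurv u x = tensorContraction (metricInv u x) (secondFF u · · x) := rfl

theorem normSqTensor_eq_tensorInner (B : Fin 2 → Fin 2 → Plane → C2) :
    normSqTensor u B x = tensorInner u x (B · · x) (B · · x) := rfl

theorem evalDiag_eq_tensorContraction (B : Fin 2 → Fin 2 → Plane → C2) (V : Plane → C2) :
    evalDiag u B V x = tensorContraction
      (Matrix.vecMulVec (tangComp u x (V x)) (tangComp u x (V x))) (B · · x) := rfl

theorem Qop_eq_tensorContraction (B : Fin 2 → Fin 2 → Plane → C2) (φ : Plane → C2) :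
    Qop u B φ x = tensorContraction
      (metricInv u x * Matrix.of (fun k l => inner ℝ (B k l x) (φ x)) * metricInv u x)
      (B · · x) := by
  have h := (metricInv_isSymm u x).apply 0 1
  simp only [Qop, tensorContraction_apply, Matrix.mul_apply, Matrix.of_apply, Fin.sum_univ_two, h]
  module

theorem lagrangianTrace_eq (i j : Fin 2) : lagrangianTrace u x i j
    = metric u x i j • meanCurv u x - contract u (meanCurv u) i x • J (pd j u x)
      - contract u (meanCurv u) j x • J (pd i u x) := by
  simp only [lagrangianTrace, contract_apply, inner_J_left (pd _ u x), real_inner_comm (J _)]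
  module

variable {u x}

theorem metricInv_mulVec_contract (φ : Plane → C2) :
    metricInv u x *ᵥ (contract u φ · x) = tangComp u x (J (φ x)) := by
  rw [tangComp_eq_mulVec]
  simp only [contract_apply]

theorem tensorContraction_lagrangianTrace {s : Matrix (Fin 2) (Fin 2) ℝ} (hs : s.IsSymm) :
    tensorContraction s (lagrangianTrace u x) = (s * metric u x).trace • meanCurv u x
      - (2 : ℝ) • ∑ j, (s *ᵥ (contract u (meanCurv u) · x)) j • J (pd j u x) := by
  have hs01 := hs.apply 0 1
  have hg01 := (metric_isSymm u x).apply 0 1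
  simp only [tensorContraction_apply, lagrangianTrace_eq, Matrix.trace_fin_two, Matrix.mul_apply,
    Matrix.mulVec, dotProduct, Fin.sum_univ_two, hs01, hg01]
  module

theorem tensorContraction_smul_const (s b : Matrix (Fin 2) (Fin 2) ℝ) (N : C2) :
    tensorContraction s (fun i j => b i j • N) = (s * bᵀ).trace • N := by
  simp only [tensorContraction_apply, Matrix.trace, Matrix.diag, Matrix.mul_apply,
    Matrix.transpose_apply, Finset.sum_smul, mul_smul]

theorem trace_metricInv_mul_secondFFAlong (hA : ∀ i j, secondFF u i j x = secondFF u j i x)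
    (N : C2) : (metricInv u x * secondFFAlong u x N).trace = inner ℝ N (meanCurv u x) := by
  rw [inner_meanCurv]
  simp only [Matrix.trace, Matrix.diag, Matrix.mul_apply, secondFFAlong, Matrix.of_apply]
  refine Finset.sum_congr rfl fun i _ => Finset.sum_congr rfl fun j _ => ?_
  rw [hA, real_inner_comm]

theorem Qop_tracefreeA (hg : (metric u x).det ≠ 0)
    (hA : ∀ i j, secondFF u i j x = secondFF u j i x) : Qop u (tracefreeA u) (meanCurv u) x
      = Qop u (secondFF u) (meanCurv u) x
        - ((1 / 2 : ℝ) * ‖meanCurv u x‖ ^ 2) • meanCurv u x := by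
  have hinner : (Matrix.of fun k l => inner ℝ (tracefreeA u k l x) (meanCurv u x))
      = secondFFAlong u x (meanCurv u x) - (‖meanCurv u x‖ ^ 2 / 2) • metric u x := by
    ext k l
    simp only [secondFFAlong, tracefreeA, inner_sub_left, real_inner_smul_left,
      real_inner_self_eq_norm_sq, Matrix.of_apply, Matrix.sub_apply, Matrix.smul_apply, smul_eq_mul]
    ring
  have htrace : ∀ b : Matrix (Fin 2) (Fin 2) ℝ,
      tensorContraction (b * metricInv u x) (fun i j => metric u x i j • meanCurv u x)
        = b.trace • meanCurv u x := fun b => by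
    rw [tensorContraction_smul_const, (metric_isSymm u x).eq, Matrix.mul_assoc,
      metricInv_mul_metric hg, Matrix.mul_one]
  have hone := htrace 1
  rw [Matrix.one_mul, Matrix.trace_one, Fintype.card_fin] at hone
  simp only [Qop_eq_tensorContraction, hinner, Matrix.mul_sub, Matrix.sub_mul, Matrix.mul_smul,
    Matrix.smul_mul, metricInv_mul_metric hg, Matrix.one_mul, tracefreeA_eq_sub, map_sub, map_smul,
    LinearMap.sub_apply, LinearMap.smul_apply, htrace, hone, ← meanCurv_eq_tensorContraction,
    trace_metricInv_mul_secondFFAlong hA, real_inner_self_eq_norm_sq]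
  rw [secondFFAlong]
  module

namespace IsLagrangianChart

variable {U : Set Plane} (hu : IsLagrangianChart u U) (hx : x ∈ U)

include hu hx

theorem sum_tangComp_J_meanCurv_smul :
    ∑ i, tangComp u x (J (meanCurv u x)) i • J (pd i u x) = -meanCurv u x :=
  hu.sum_tangComp_smul_J_pd hx (isNormal_meanCurv (hu.det_metric_ne_zero hx))

theorem tensorContraction_metricInv_lagrangianTrace :
    tensorContraction (metricInv u x) (lagrangianTrace u x) = (4 : ℝ) • meanCurv u x := by
  rw [tensorContraction_lagrangianTrace (metricInv_isSymm u x),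
    metricInv_mul_metric (hu.det_metric_ne_zero hx), metricInv_mulVec_contract,
    hu.sum_tangComp_J_meanCurv_smul hx, Matrix.trace_one, Fintype.card_fin]
  module

theorem tangComp_J_meanCurv_dotProduct_contract :
    tangComp u x (J (meanCurv u x)) ⬝ᵥ (contract u (meanCurv u) · x) = ‖meanCurv u x‖ ^ 2 := by
  have h := congrArg (inner ℝ (-meanCurv u x)) (hu.sum_tangComp_J_meanCurv_smul hx)
  simp only [inner_neg_neg, real_inner_self_eq_norm_sq, inner_sum, real_inner_smul_right] at h
  simp only [← h, dotProduct, contract_apply, inner_J_left, inner_neg_left]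

theorem tensorContraction_vecMulVec_lagrangianTrace :
    tensorContraction (Matrix.vecMulVec (tangComp u x (J (meanCurv u x)))
      (tangComp u x (J (meanCurv u x)))) (lagrangianTrace u x)
      = (3 * ‖meanCurv u x‖ ^ 2) • meanCurv u x := by
  have hg : tangComp u x (J (meanCurv u x)) ᵥ* metric u x = (contract u (meanCurv u) · x) :=
    funext fun k => by
      rw [contract_apply, ← sum_tangComp_mul_metric (hu.det_metric_ne_zero hx), Matrix.vecMul,
        dotProduct]
  rw [tensorContraction_lagrangianTrace (Matrix.transpose_vecMulVec _ _), Matrix.vecMulVec_mul,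
    hg, Matrix.trace_vecMulVec, Matrix.vecMulVec_mulVec,
    hu.tangComp_J_meanCurv_dotProduct_contract hx]
  simp only [Pi.smul_apply, op_smul_eq_smul, smul_assoc, ← Finset.smul_sum,
    hu.sum_tangComp_J_meanCurv_smul hx]
  module

/-- This is the full symmetry of `⟨A(·, ·), J ·⟩`, with two of the slots filled by `JH`. -/
theorem secondFFAlong_mulVec_tangComp : secondFFAlong u x (meanCurv u x)
      *ᵥ tangComp u x (J (meanCurv u x))
      = (contract u (evalDiag u (secondFF u) fun y => J (meanCurv u y)) · x) := funext fun l => by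
  set v := tangComp u x (J (meanCurv u x))
  have hrow : ∀ i, inner ℝ (secondFF u i l x) (meanCurv u x)
      = -∑ j, v j * inner ℝ (secondFF u i j x) (J (pd l u x)) := fun i => by
    rw [← neg_neg (meanCurv u x), ← hu.sum_tangComp_J_meanCurv_smul hx, inner_neg_right, inner_sum]
    simp only [real_inner_smul_right, hu.inner_secondFF_J_pd_symm hx i l, v]
  rw [contract_apply, inner_J_left, evalDiag, Matrix.mulVec, dotProduct, sum_inner,
    ← Finset.sum_neg_distrib]
  refine Finset.sum_congr rfl fun i _ => ?_
  rw [secondFFAlong, Matrix.of_apply, hu.secondFF_symm hx, hrow, sum_inner, neg_mul, Finset.sum_mul]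
  simp only [real_inner_smul_left, v]
  refine congrArg _ (Finset.sum_congr rfl fun j _ => ?_)
  ring

theorem tensorContraction_secondFFAlong_lagrangianTrace :
    tensorContraction (metricInv u x * secondFFAlong u x (meanCurv u x) * metricInv u x)
        (lagrangianTrace u x)
      = ‖meanCurv u x‖ ^ 2 • meanCurv u x
        + (2 : ℝ) • evalDiag u (secondFF u) (fun y => J (meanCurv u y)) x := by
  have hg := hu.det_metric_ne_zero hx
  have hsymm : (secondFFAlong u x (meanCurv u x))ᵀ = secondFFAlong u x (meanCurv u x) :=
    Matrix.ext fun i j => by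
      rw [Matrix.transpose_apply, secondFFAlong, Matrix.of_apply, Matrix.of_apply,
        hu.secondFF_symm hx]
  have hs : (metricInv u x * secondFFAlong u x (meanCurv u x) * metricInv u x).IsSymm := by
    rw [Matrix.IsSymm, Matrix.transpose_mul, Matrix.transpose_mul, (metricInv_isSymm u x).eq,
      hsymm, Matrix.mul_assoc]
  have hnormal : IsNormal u x (evalDiag u (secondFF u) (fun y => J (meanCurv u y)) x) := fun k => by
    simp only [evalDiag, sum_inner, real_inner_smul_left, isNormal_secondFF hg _ _ k, mul_zero,
      Finset.sum_const_zero]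
  rw [tensorContraction_lagrangianTrace hs, Matrix.mul_assoc _ (metricInv u x),
    metricInv_mul_metric hg, Matrix.mul_one,
    trace_metricInv_mul_secondFFAlong fun _ _ => hu.secondFF_symm hx _ _,
    real_inner_self_eq_norm_sq, ← Matrix.mulVec_mulVec, metricInv_mulVec_contract,
    ← Matrix.mulVec_mulVec, hu.secondFFAlong_mulVec_tangComp hx, metricInv_mulVec_contract,
    hu.sum_tangComp_smul_J_pd hx hnormal, smul_neg, sub_neg_eq_add]

theorem evalDiag_checkA : evalDiag u (checkA u) (fun y => J (meanCurv u y)) x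
      = evalDiag u (secondFF u) (fun y => J (meanCurv u y)) x
        - ((3 / 4 : ℝ) * ‖meanCurv u x‖ ^ 2) • meanCurv u x := by
  rw [evalDiag_eq_tensorContraction, checkA_eq_sub, map_sub, map_smul,
    hu.tensorContraction_vecMulVec_lagrangianTrace hx,
    ← evalDiag_eq_tensorContraction u x _ fun y => J (meanCurv u y)]
  module

theorem Qop_checkA : Qop u (checkA u) (meanCurv u) x = Qop u (secondFF u) (meanCurv u) x
      + ((1 / 8 : ℝ) * ‖meanCurv u x‖ ^ 2) • meanCurv u x
      - evalDiag u (secondFF u) (fun y => J (meanCurv u y)) x := by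
  have hg := hu.det_metric_ne_zero hx
  set θ : Fin 2 → ℝ := (contract u (meanCurv u) · x)
  have hinner : (Matrix.of fun k l => inner ℝ (checkA u k l x) (meanCurv u x))
      = secondFFAlong u x (meanCurv u x) - (‖meanCurv u x‖ ^ 2 / 4) • metric u x
        - (1 / 2 : ℝ) • Matrix.vecMulVec θ θ := by
    ext k l
    simp only [θ, secondFFAlong, checkA, contract_apply, inner_sub_left, inner_add_left,
      real_inner_smul_left, real_inner_self_eq_norm_sq, Matrix.of_apply, Matrix.sub_apply,
      Matrix.smul_apply, Matrix.vecMulVec_apply, smul_eq_mul, inner_J_left (meanCurv u x),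
      real_inner_comm (J _)]
    ring
  have hraise : metricInv u x * Matrix.vecMulVec θ θ * metricInv u x
      = Matrix.vecMulVec (tangComp u x (J (meanCurv u x))) (tangComp u x (J (meanCurv u x))) := by
    rw [Matrix.mul_vecMulVec, Matrix.vecMulVec_mul, ← Matrix.mulVec_transpose,
      (metricInv_isSymm u x).eq, metricInv_mulVec_contract]
  simp only [Qop_eq_tensorContraction, hinner, Matrix.mul_sub, Matrix.sub_mul, Matrix.mul_smul,
    Matrix.smul_mul, metricInv_mul_metric hg, Matrix.one_mul, hraise, checkA_eq_sub, map_sub,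
    map_smul, LinearMap.sub_apply, LinearMap.smul_apply, ← meanCurv_eq_tensorContraction,
    hu.tensorContraction_secondFFAlong_lagrangianTrace hx,
    hu.tensorContraction_metricInv_lagrangianTrace hx,
    hu.tensorContraction_vecMulVec_lagrangianTrace hx]
  rw [secondFFAlong, evalDiag_eq_tensorContraction]
  module

theorem Qop_tracefreeA_eq_Qop_checkA : Qop u (tracefreeA u) (meanCurv u) x
      = ((1 / 8 : ℝ) * ‖meanCurv u x‖ ^ 2) • meanCurv u x + Qop u (checkA u) (meanCurv u) x
        + evalDiag u (checkA u) (fun y => J (meanCurv u y)) x := by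
  rw [Qop_tracefreeA (hu.det_metric_ne_zero hx) fun _ _ => hu.secondFF_symm hx _ _,
    hu.Qop_checkA hx, hu.evalDiag_checkA hx]
  module

theorem tensorInner_lagrangianTrace {B : Fin 2 → Fin 2 → C2} (hB : ∀ i j, B i j = B j i)
    (hcubic : ∀ i j k, inner ℝ (B i j) (J (pd k u x)) = inner ℝ (B i k) (J (pd j u x))) :
    tensorInner u x B (lagrangianTrace u x)
      = 3 * inner ℝ (tensorContraction (metricInv u x) B) (meanCurv u x) := by
  set C : Fin 2 → Fin 2 → C2 := fun k l => contract u (meanCurv u) k x • J (pd l u x)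
  have hS : lagrangianTrace u x
      = (fun k l => metric u x k l • meanCurv u x) - C - fun k l => C l k :=
    funext₂ fun k l => lagrangianTrace_eq u x k l
  have hC : tensorInner u x B C
      = -inner ℝ (tensorContraction (metricInv u x) B) (meanCurv u x) := by
    rw [tensorInner_smul, metricInv_mulVec_contract, ← inner_neg_right,
      ← hu.sum_tangComp_J_meanCurv_smul hx, inner_sum]
    refine Finset.sum_congr rfl fun i _ => ?_
    rw [real_inner_smul_right, tensorContraction_apply]
    simp only [sum_inner, real_inner_smul_left]
    refine congrArg _ (Finset.sum_congr rfl fun j _ => Finset.sum_congr rfl fun l _ => ?_)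
    rw [hB i j, hcubic j i l]
  rw [hS, map_sub, map_sub, tensorInner_swap u x hB C, hC,
    tensorInner_metric_smul (hu.det_metric_ne_zero hx)]
  ring

theorem tensorInner_lagrangianTrace_self :
    tensorInner u x (lagrangianTrace u x) (lagrangianTrace u x) = 12 * ‖meanCurv u x‖ ^ 2 := by
  have hS : ∀ i j, lagrangianTrace u x i j = lagrangianTrace u x j i := fun i j => by
    rw [lagrangianTrace_eq, lagrangianTrace_eq, (metric_isSymm u x).apply, sub_right_comm]
  have hcubic : ∀ i j k, inner ℝ (lagrangianTrace u x i j) (J (pd k u x))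
      = inner ℝ (lagrangianTrace u x i k) (J (pd j u x)) := fun i j k => by
    simp only [lagrangianTrace_eq, inner_sub_left, real_inner_smul_left, inner_J_J, contract_apply,
      inner_J_left (meanCurv u x), ← metric_apply, (metric_isSymm u x).apply j k]
    ring
  rw [hu.tensorInner_lagrangianTrace hx hS hcubic,
    hu.tensorContraction_metricInv_lagrangianTrace hx, real_inner_smul_left,
    real_inner_self_eq_norm_sq]
  ring

theorem normSqTensor_checkA : normSqTensor u (checkA u) x
      = normSqTensor u (secondFF u) x - 3 / 4 * ‖meanCurv u x‖ ^ 2 := by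
  have hA : tensorInner u x (secondFF u · · x) (lagrangianTrace u x) = 3 * ‖meanCurv u x‖ ^ 2 := by
    rw [hu.tensorInner_lagrangianTrace hx (fun _ _ => hu.secondFF_symm hx _ _)
      (hu.inner_secondFF_J_pd_symm hx), ← meanCurv_eq_tensorContraction,
      real_inner_self_eq_norm_sq]
  simp only [normSqTensor_eq_tensorInner, checkA_eq_sub, map_sub, map_smul, LinearMap.sub_apply,
    LinearMap.smul_apply, smul_eq_mul,
    tensorInner_comm u x (lagrangianTrace u x) (secondFF u · · x), hA,
    hu.tensorInner_lagrangianTrace_self hx]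
  ring

end IsLagrangianChart

end TensorAlgebra

/-! ### The Willmore operator -/

section WillmoreOperator

namespace IsLagrangianChart

variable {u : Plane → C2} {U : Set Plane} {x : Plane} (hu : IsLagrangianChart u U) (hx : x ∈ U)

include hu hx

theorem willmoreOp_eq : willmoreOp u x = normalLaplacian u (meanCurv u) x
      + ((1 / 8 : ℝ) * ‖meanCurv u x‖ ^ 2) • meanCurv u x + Qop u (checkA u) (meanCurv u) x
      + evalDiag u (checkA u) (fun y => J (meanCurv u y)) x := by
  rw [willmoreOp, hu.Qop_tracefreeA_eq_Qop_checkA hx, ← add_assoc, ← add_assoc]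

/-- Since `H ⌟ ω` is closed and dual to the tangent field `JH`, this is the Bochner formula. -/
theorem neg_adjointDeriv_covDerivForm_contract_meanCurv (k : Fin 2) :
    -adjointDeriv u (covDerivForm u (contract u (meanCurv u))) k x
      = pd k (divergence u fun y => J (meanCurv u y)) x
        + gaussCurvature u x * contract u (meanCurv u) k x := by
  simp only [contract_eq_flat]
  refine hu.neg_adjointDeriv_covDerivForm_flat hx (contDiffOn_J hu.contDiffOn_meanCurv)
    (fun y hy => hu.isTangent_J hy (isNormal_meanCurv (hu.det_metric_ne_zero hy)))
    (fun i j y hy => ?_) k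
  rw [← contract_eq_flat, hu.covDerivForm_contract_meanCurv_symm hy]

theorem adjointDeriv_tensorT (k : Fin 2) : adjointDeriv u (tensorT u) k x
      = adjointDeriv u (covDerivForm u (contract u (meanCurv u))) k x
        + 1 / 2 * pd k (divergence u fun y => J (meanCurv u y)) x := by
  have hJH : ContDiffOn ℝ ∞ (fun y => J (meanCurv u y)) U := contDiffOn_J hu.contDiffOn_meanCurv
  have hdiv := hu.contDiffOn_divergence hJH
  have hc : ContDiffOn ℝ ∞ (fun y => 1 / 2 * divergence u (fun y => J (meanCurv u y)) y) U :=
    contDiffOn_const.mul hdiv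
  have hform : ∀ i j, ContDiffOn ℝ ∞ (covDerivForm u (contract u (meanCurv u)) i j) U := by
    rw [contract_eq_flat]
    exact fun i j => hu.contDiffOn_covDerivForm (hu.contDiffOn_flat hJH) i j
  have hsub := hu.adjointDeriv_sub hx hform (fun i j => hc.mul (hu.contDiffOn_metric i j)) k
  rw [hu.adjointDeriv_mul_metric hx hc,
    pd_mul (differentiableAt_const _) (hu.differentiableAt hx hdiv), pd_const] at hsub
  rw [zero_mul, zero_add, sub_neg_eq_add] at hsub
  exact hsub

theorem contract_normalLaplacian_meanCurv (k : Fin 2) :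
    contract u (normalLaplacian u (meanCurv u)) k x = -2 * adjointDeriv u (tensorT u) k x
      + 1 / 2 * (normSqTensor u (secondFF u) x - ‖meanCurv u x‖ ^ 2)
        * contract u (meanCurv u) k x := by
  rw [hu.contract_normalLaplacian hx hu.contDiffOn_meanCurv
    (fun y hy => isNormal_meanCurv (hu.det_metric_ne_zero hy)), hu.adjointDeriv_tensorT hx]
  have hbochner := hu.neg_adjointDeriv_covDerivForm_contract_meanCurv hx k
  have hgauss := hu.norm_meanCurv_sq_sub_normSqTensor hx
  linear_combination (-1) * hbochner + 1 / 2 * contract u (meanCurv u) k x * hgauss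

theorem contract_willmoreOp (k : Fin 2) : contract u (willmoreOp u) k x
      = -2 * adjointDeriv u (tensorT u) k x
        + (1 / 2) * normSqTensor u (checkA u) x * contract u (meanCurv u) k x
        + contract u (Qop u (checkA u) (meanCurv u)) k x
        + contract u (evalDiag u (checkA u) fun y => J (meanCurv u y)) k x := by
  have hexpand : contract u (willmoreOp u) k x = contract u (normalLaplacian u (meanCurv u)) k x
      + 1 / 8 * ‖meanCurv u x‖ ^ 2 * contract u (meanCurv u) k x
      + contract u (Qop u (checkA u) (meanCurv u)) k x
      + contract u (evalDiag u (checkA u) fun y => J (meanCurv u y)) k x := by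
    simp only [contract_apply, hu.willmoreOp_eq hx, J_add, J_smul, inner_add_left,
      real_inner_smul_left]
  rw [hexpand, hu.contract_normalLaplacian_meanCurv hx, hu.normSqTensor_checkA hx]
  ring

end IsLagrangianChart

end WillmoreOperator

/-! ### Charts of a Lagrangian immersion -/

section Immersion

theorem det_metric_ne_zero_of_injective {u : Plane → C2} {x : Plane}
    (h : Function.Injective (fderiv ℝ u x)) : (metric u x).det ≠ 0 := by
  have hlin : LinearIndependent ℝ fun i => pd i u x := by
    simpa [Function.comp_def, pd] using
      (EuclideanSpace.basisFun (Fin 2) ℝ).toBasis.linearIndependent.map'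
        (fderiv ℝ u x).toLinearMap (LinearMap.ker_eq_bot.2 h)
  exact Matrix.det_gram_ne_zero_iff_linearIndependent.2 hlin

variable {M : Type*} [TopologicalSpace M] [ChartedSpace Plane M]
  {e : OpenPartialHomeomorph M Plane}

theorem mdifferentiable_of_mem_maximalAtlas (he : e ∈ IsManifold.maximalAtlas 𝓘(ℝ, Plane) ∞ M) :
    e.MDifferentiable 𝓘(ℝ, Plane) 𝓘(ℝ, Plane) :=
  ⟨(contMDiffOn_of_mem_maximalAtlas he).mdifferentiableOn (by simp),
    (contMDiffOn_symm_of_mem_maximalAtlas he).mdifferentiableOn (by simp)⟩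

theorem IsLagrangianImmersion.isLagrangianChart {f : M → C2} (hf : IsLagrangianImmersion f)
    (he : e ∈ IsManifold.maximalAtlas 𝓘(ℝ, Plane) ∞ M) :
    IsLagrangianChart (f ∘ e.symm) e.target := by
  have hdiff := mdifferentiable_of_mem_maximalAtlas he
  have hchain : ∀ y ∈ e.target, ⇑(fderiv ℝ (f ∘ e.symm) y)
      = mfderiv 𝓘(ℝ, Plane) 𝓘(ℝ, C2) f (e.symm y)
        ∘ mfderiv 𝓘(ℝ, Plane) 𝓘(ℝ, Plane) e.symm y := fun y hy => by
    rw [← mfderiv_eq_fderiv, mfderiv_comp y ((hf.smooth _).mdifferentiableAt (by simp))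
      (hdiff.mdifferentiableAt_symm hy)]
    rfl
  refine ⟨⟨e.open_target, ?_, fun y hy => ?_⟩, fun y hy i j => ?_⟩
  · exact (hf.smooth.comp_contMDiffOn (contMDiffOn_symm_of_mem_maximalAtlas he)).contDiffOn
  · refine det_metric_ne_zero_of_injective ?_
    rw [hchain y hy]
    exact (hf.injective_mfderiv _).comp (hdiff.symm.mfderiv_injective hy)
  · rw [pd, pd, hchain y hy]
    exact hf.lagrangian _ _ _

end Immersion

end LagrangianSurface

theorem mainTheorem4 {M : Type*} [TopologicalSpace M] [ChartedSpace LagrangianSurface.Plane M]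
    [IsManifold 𝓘(ℝ, LagrangianSurface.Plane) ∞ M] (f : M → LagrangianSurface.C2)
    (hf : LagrangianSurface.IsLagrangianImmersion f)
    (e : OpenPartialHomeomorph M LagrangianSurface.Plane)
    (he : e ∈ IsManifold.maximalAtlas 𝓘(ℝ, LagrangianSurface.Plane) ∞ M)
    (u : LagrangianSurface.Plane → LagrangianSurface.C2) (hu : u = f ∘ e.symm)
    (x : LagrangianSurface.Plane) (hx : x ∈ e.target) :
    LagrangianSurface.willmoreOp u x =
        LagrangianSurface.normalLaplacian u (LagrangianSurface.meanCurv u) x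
        + ((1 / 8 : ℝ) * ‖LagrangianSurface.meanCurv u x‖ ^ 2) • LagrangianSurface.meanCurv u x
        + LagrangianSurface.Qop u (LagrangianSurface.checkA u) (LagrangianSurface.meanCurv u) x
        + LagrangianSurface.evalDiag u (LagrangianSurface.checkA u)
            (fun y => LagrangianSurface.J (LagrangianSurface.meanCurv u y)) x ∧
    ∀ k : Fin 2,
      LagrangianSurface.contract u (LagrangianSurface.willmoreOp u) k x =
        -2 * LagrangianSurface.adjointDeriv u (LagrangianSurface.tensorT u) k x
        + (1 / 2) * LagrangianSurface.normSqTensor u (LagrangianSurface.checkA u) x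
            * LagrangianSurface.contract u (LagrangianSurface.meanCurv u) k x
        + LagrangianSurface.contract u
            (LagrangianSurface.Qop u (LagrangianSurface.checkA u)
              (LagrangianSurface.meanCurv u)) k x
        + LagrangianSurface.contract u
            (LagrangianSurface.evalDiag u (LagrangianSurface.checkA u)
              (fun y => LagrangianSurface.J (LagrangianSurface.meanCurv u y))) k x := by
  subst hu
  have h := hf.isLagrangianChart he
  exact ⟨h.willmoreOp_eq hx, fun k => h.contract_willmoreOp hx k⟩
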